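/- Let $\Gamma$ be a group with a finite generating set $S$ and word metric $d_\Gamma(g,h)=|g^{-1}h|_S$. Let $(X_k)_{k\in\mathbf N}$ be a family of $d$-regular expanders, i.e. finite connected $d$-regular (simple) graphs with $n_k=|X_k|\to\infty$ whose combinatorial Laplacians $\Delta_k$ satisfy $\lambda_1(X_k)\ge\varepsilon$ for some $\varepsilon>0$ independent of $k$. Suppose that this family coarsely embeds in $\Gamma$ (so $\Gamma$ is a Gromov monster): there are maps $f_k:X_k\to\Gamma$ and functions $\rho_\pm:[0,\infty)\to[0,\infty)$, independent of $k$, with $\lim_{t\to\infty}\rho_\pm(t)=\infty$ and $\rho_-(d_{X_k}(x,y))\le d_\Gamma(f_k(x),f_k(y))\le\rho_+(d_{X_k}(x,y))$ for all $k$ and all $x,y\in X_k$. A $C^*$-algebra $C$ is called half-$K$-exact if, for every short exact sequence $0\to J\to A\to B\to 0$ of $C^*$-algebras, the sequences $K_*(J\otimes_{\min}C)\to K_*(A\otimes_{\min}C)\to K_*(B\otimes_{\min}C)$, $*=0,1$, are exact in the middle term. Then $C^*_r(\Gamma)$ is not half-$K$-exact. More precisely, let $M=\prod_k M_{n_k}(\mathbf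 C)$ (bounded families) and $J=\oplus_k M_{n_k}(\mathbf C)$ (families whose norms tend to $0$), where $M_{n_k}(\mathbf C)$ is identified with $\mathrm{End}(\ell^2(X_k))$, and let $\iota_k:M_{n_k}(\mathbf C)\to M_{n_k}(\mathbf C)\otimes C^*_r(\Gamma)$ be the linear map given on matrix units by $\iota_k(E_{xy})=E_{xy}\otimes f_k(x)^{-1}f_k(y)$. Let $p_k\in M_{n_k}(\mathbf C)$ be the projection onto $\ker\Delta_k$, i.e. the matrix with all entries $1/n_k$. Then: 1. There are unique elements $\Delta$ and $q$ of $M\otimes_{\min}C^*_r(\Gamma)$ whose images in the factors $M_{n_k}(\mathbf C)\otimes C^*_r(\Gamma)$ are $\iota_k(\Delta_k)$, respectively $\iota_k(p_k)$, for all $k$. The element $\Delta$ is self-adjoint, its spectrum is contained in $\{0\}\cup[\delta,\infty)$ for some $\delta>0$, and $q$ is a projection, namely the spectral projection $q=1-\chi_{\mathbf R\setminus\{0\}}(\Delta)$ of $\Delta$ associated with $0$. 2. The class $[q]\in K_0(M\otimes_{\min}C^*_r(\Gamma))$ is mapped to $0$ in $K_0((M/J)\otimes_{\min}C^*_r(\Gamma))$.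 3. The class $[q]$ is not in the image of $K_0(J\otimes_{\min}C^*_r(\Gamma))\to K_0(M\otimes_{\min}C^*_r(\Gamma))$. -/

import Mathlib

open scoped ENNReal NNReal TensorProduct ComplexOrder ZeroAtInfty
open Filter Topology
universe u v w
noncomputable section

section
variable (A : ℕ → Type v) [∀ k, NonUnitalCStarAlgebra (A k)]

/-- The product C*-algebra `∏ₖ Aₖ` of bounded families, with the supremum norm. -/
abbrev ProdAlg : Type v := lp A ∞

/-- The ideal `⊕ₖ Aₖ` of the families whose norms tend to zero (the C*-algebraic direct sum). -/
def sumIdeal : NonUnitalStarSubalgebra ℂ (ProdAlg A) where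
  carrier := {x | Tendsto (fun k => ‖x k‖) atTop (𝓝 0)}
  add_mem' {x y} hx hy := by
    refine squeeze_zero (fun _ => norm_nonneg _) (fun k => ?_) (by simpa using hx.add hy)
    simpa using norm_add_le (x k) (y k)
  zero_mem' := by simp
  mul_mem' {x y} hx hy := by
    refine squeeze_zero (fun _ => norm_nonneg _) (fun k => ?_) (by simpa using hx.mul hy)
    simpa using norm_mul_le (x k) (y k)
  smul_mem' c x hx := by
    refine squeeze_zero (fun _ => norm_nonneg _) (fun k => ?_) (by simpa using hx.const_mul ‖c‖)
    simp [norm_smul]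
  star_mem' {x} hx := by simpa using hx

theorem norm_coord_le (x : ProdAlg A) (k : ℕ) : ‖x k‖ ≤ ‖x‖ :=
  lp.norm_apply_le_norm (by simp) x k

instance isClosed_sumIdeal : IsClosed (sumIdeal A : Set (ProdAlg A)) := by
  refine isClosed_of_closure_subset fun x hx => ?_
  change Tendsto (fun k => ‖x k‖) atTop (𝓝 0)
  rw [Metric.tendsto_atTop]
  intro ε hε
  obtain ⟨y, hy, hxy⟩ := Metric.mem_closure_iff.1 hx (ε / 2) (by positivity)
  obtain ⟨N, hN⟩ := (Metric.tendsto_atTop.1 hy) (ε / 2) (by positivity)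
  refine ⟨N, fun k hk => ?_⟩
  have h1 := hN k hk
  have h2 : ‖x k - y k‖ ≤ ‖x - y‖ := norm_coord_le A (x - y) k
  rw [dist_eq_norm] at hxy
  simp only [Real.dist_eq, sub_zero, abs_norm] at h1 ⊢
  have h3 := norm_add_le (x k - y k) (y k)
  rw [sub_add_cancel] at h3
  linarith

/-- The projection of `∏ₖ Aₖ` onto its `k`-th factor. -/
def coordHom (k : ℕ) : ProdAlg A →⋆ₙₐ[ℂ] A k where
  toFun x := x k
  map_smul' _ _ := rfl
  map_zero' := rfl
  map_add' _ _ := rfl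
  map_mul' _ _ := rfl
  map_star' _ := rfl

theorem sumIdeal_mul_mem (a x : ProdAlg A) (hx : x ∈ sumIdeal A) : a * x ∈ sumIdeal A := by
  refine squeeze_zero (fun _ => norm_nonneg _) (fun k => ?_) (by simpa using Tendsto.const_mul ‖a‖ hx)
  calc ‖a k * x k‖ ≤ ‖a k‖ * ‖x k‖ := norm_mul_le _ _
    _ ≤ _ := by gcongr; exact norm_coord_le A a k

theorem mul_sumIdeal_mem (x a : ProdAlg A) (hx : x ∈ sumIdeal A) : x * a ∈ sumIdeal A := by
  have := star_mem (sumIdeal_mul_mem A (star a) (star x) (star_mem hx))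
  simpa using this

abbrev sumSubmodule : Submodule ℂ (ProdAlg A) := (sumIdeal A).toNonUnitalSubalgebra.toSubmodule

instance : IsClosed (sumSubmodule A : Set (ProdAlg A)) := isClosed_sumIdeal A

/-- The quotient C*-algebra `(∏ₖ Aₖ) / (⊕ₖ Aₖ)`, with the quotient norm. -/
def QuotAlg : Type v := ProdAlg A ⧸ sumSubmodule A

namespace QuotAlg

instance : NormedAddCommGroup (QuotAlg A) :=
  inferInstanceAs (NormedAddCommGroup (ProdAlg A ⧸ sumSubmodule A))
instance : NormedSpace ℂ (QuotAlg A) :=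
  inferInstanceAs (NormedSpace ℂ (ProdAlg A ⧸ sumSubmodule A))
instance : CompleteSpace (QuotAlg A) :=
  inferInstanceAs (CompleteSpace (ProdAlg A ⧸ sumSubmodule A))

/-- The quotient map, as a linear map. -/
def mk : ProdAlg A →ₗ[ℂ] QuotAlg A := (sumSubmodule A).mkQ

variable {A}
theorem mk_surjective : Function.Surjective (mk A) := Submodule.mkQ_surjective _

theorem mk_eq_mk {x y : ProdAlg A} : mk A x = mk A y ↔ x - y ∈ sumIdeal A :=
  Submodule.Quotient.eq _

theorem norm_mk_le (x : ProdAlg A) : ‖mk A x‖ ≤ ‖x‖ := Submodule.Quotient.norm_mk_le _ x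

theorem exists_norm_lt (z : QuotAlg A) {ε : ℝ} (hε : 0 < ε) : ∃ x, mk A x = z ∧ ‖x‖ < ‖z‖ + ε :=
  Submodule.Quotient.norm_mk_lt z hε

instance : Mul (QuotAlg A) where
  mul := Quotient.map₂ (· * ·) fun a b hab c d hcd => by
    have hab' : a - b ∈ sumIdeal A := (Submodule.quotientRel_def _).1 hab
    have hcd' : c - d ∈ sumIdeal A := (Submodule.quotientRel_def _).1 hcd
    refine (Submodule.quotientRel_def _).2 ?_
    have : a * c - b * d = (a - b) * c + b * (c - d) := by noncomm_ring
    change a * c - b * d ∈ sumIdeal A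
    rw [this]
    exact add_mem (mul_sumIdeal_mem A _ _ hab') (sumIdeal_mul_mem A _ _ hcd')

instance : Star (QuotAlg A) where
  star := Quotient.map star fun a b hab => by
    have hab' : a - b ∈ sumIdeal A := (Submodule.quotientRel_def _).1 hab
    refine (Submodule.quotientRel_def _).2 ?_
    change star a - star b ∈ sumIdeal A
    rw [← star_sub]
    exact star_mem hab'

theorem mk_mul (x y : ProdAlg A) : mk A (x * y) = mk A x * mk A y := rfl
theorem mk_star (x : ProdAlg A) : mk A (star x) = star (mk A x) := rfl

theorem norm_mul_self_aux (x : ProdAlg A) : ‖mk A x‖ * ‖mk A x‖ ≤ ‖mk A (star x * x)‖ := by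
  refine le_of_forall_pos_le_add fun ε hε => ?_
  obtain ⟨y, hy, hyn⟩ := exists_norm_lt (mk A (star x * x)) (half_pos hε)
  have hj : star x * x - y ∈ sumIdeal A := mk_eq_mk.1 hy.symm
  obtain ⟨N, hN⟩ := (Metric.tendsto_atTop.1 hj) (ε / 2) (half_pos hε)
  set c : ℝ := ‖mk A (star x * x)‖ + ε with hc
  have hc0 : 0 ≤ c := by positivity
  have hxk : ∀ k, N ≤ k → ‖x k‖ ≤ √c := fun k hk => by
    refine Real.le_sqrt_of_sq_le ?_
    have h1 := hN k hk
    simp only [Real.dist_eq, sub_zero, abs_norm] at h1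
    have h2 : ‖star (x k) * x k‖ = ‖x k‖ * ‖x k‖ := CStarRing.norm_star_mul_self
    have h3 : ‖star (x k) * x k - y k‖ < ε / 2 := h1
    have h4 := norm_coord_le A y k
    have h5 := norm_add_le (star (x k) * x k - y k) (y k)
    rw [sub_add_cancel, h2] at h5
    rw [sq, hc]
    linarith
  let z : ProdAlg A := ⟨fun k => if N ≤ k then x k else 0, memℓp_infty ⟨√c, by
    rintro _ ⟨k, rfl⟩
    by_cases hk : N ≤ k
    · simpa [hk] using hxk k hk
    · simp [hk, Real.sqrt_nonneg]⟩⟩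
  have hz : mk A x = mk A z := by
    refine mk_eq_mk.2 ?_
    change Tendsto (fun k => ‖x k - (if N ≤ k then x k else 0)‖) atTop (𝓝 0)
    refine tendsto_const_nhds.congr' ?_
    filter_upwards [eventually_ge_atTop N] with k hk
    simp [hk]
  have hzn : ‖z‖ ≤ √c := by
    refine lp.norm_le_of_forall_le (Real.sqrt_nonneg _) fun k => ?_
    change ‖(if N ≤ k then x k else 0 : A k)‖ ≤ _
    by_cases hk : N ≤ k
    · simpa [hk] using hxk k hk
    · simp [hk, Real.sqrt_nonneg]
  have h6 : ‖mk A x‖ ≤ √c := hz ▸ (norm_mk_le z).trans hzn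
  calc ‖mk A x‖ * ‖mk A x‖ ≤ √c * √c := by gcongr
    _ = c := Real.mul_self_sqrt hc0

instance : NonUnitalCStarAlgebra (QuotAlg A) where
  __ := (inferInstance : NormedAddCommGroup (QuotAlg A))
  __ := (inferInstance : NormedSpace ℂ (QuotAlg A))
  __ := (inferInstance : CompleteSpace (QuotAlg A))
  left_distrib a b c := by
    obtain ⟨a, rfl⟩ := mk_surjective a
    obtain ⟨b, rfl⟩ := mk_surjective b
    obtain ⟨c, rfl⟩ := mk_surjective c
    simp only [← map_add, ← mk_mul, mul_add]
  right_distrib a b c := by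
    obtain ⟨a, rfl⟩ := mk_surjective a
    obtain ⟨b, rfl⟩ := mk_surjective b
    obtain ⟨c, rfl⟩ := mk_surjective c
    simp only [← map_add, ← mk_mul, add_mul]
  zero_mul a := by
    obtain ⟨a, rfl⟩ := mk_surjective a
    rw [← map_zero (mk A), ← mk_mul, zero_mul]
  mul_zero a := by
    obtain ⟨a, rfl⟩ := mk_surjective a
    rw [← map_zero (mk A), ← mk_mul, mul_zero]
  mul_assoc a b c := by
    obtain ⟨a, rfl⟩ := mk_surjective a
    obtain ⟨b, rfl⟩ := mk_surjective b
    obtain ⟨c, rfl⟩ := mk_surjective c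
    simp only [← mk_mul, mul_assoc]
  norm_mul_le a b := by
    refine le_of_forall_pos_le_add fun ε hε => ?_
    have key : Tendsto (fun δ : ℝ => (‖a‖ + δ) * (‖b‖ + δ)) (𝓝[>] 0) (𝓝 (‖a‖ * ‖b‖)) := by
      have : Continuous fun δ : ℝ => (‖a‖ + δ) * (‖b‖ + δ) := by fun_prop
      simpa using (this.tendsto 0).mono_left nhdsWithin_le_nhds
    have hev := key.eventually (gt_mem_nhds (show ‖a‖ * ‖b‖ < ‖a‖ * ‖b‖ + ε by linarith))
    obtain ⟨δ, hδ, hδ0⟩ := (hev.and self_mem_nhdsWithin).exists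
    obtain ⟨x, rfl, hx⟩ := exists_norm_lt a hδ0
    obtain ⟨y, rfl, hy⟩ := exists_norm_lt b hδ0
    rw [← mk_mul]
    calc ‖mk A (x * y)‖ ≤ ‖x * y‖ := norm_mk_le _
      _ ≤ ‖x‖ * ‖y‖ := norm_mul_le _ _
      _ ≤ (‖mk A x‖ + δ) * (‖mk A y‖ + δ) := by gcongr
      _ ≤ _ := hδ.le
  star_involutive a := by
    obtain ⟨a, rfl⟩ := mk_surjective a
    simp only [← mk_star, star_star]
  star_mul a b := by
    obtain ⟨a, rfl⟩ := mk_surjective a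
    obtain ⟨b, rfl⟩ := mk_surjective b
    simp only [← mk_star, ← mk_mul, star_mul]
  star_add a b := by
    obtain ⟨a, rfl⟩ := mk_surjective a
    obtain ⟨b, rfl⟩ := mk_surjective b
    simp only [← mk_star, ← map_add, star_add]
  norm_mul_self_le a := by
    obtain ⟨a, rfl⟩ := mk_surjective a
    exact norm_mul_self_aux a
  smul_assoc c a b := by
    obtain ⟨a, rfl⟩ := mk_surjective a
    obtain ⟨b, rfl⟩ := mk_surjective b
    simp only [smul_eq_mul, ← map_smul, ← mk_mul, smul_mul_assoc]
  smul_comm c a b := by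
    obtain ⟨a, rfl⟩ := mk_surjective a
    obtain ⟨b, rfl⟩ := mk_surjective b
    simp only [smul_eq_mul, ← map_smul, ← mk_mul, mul_smul_comm]
  star_smul c a := by
    obtain ⟨a, rfl⟩ := mk_surjective a
    simp only [← mk_star, ← map_smul, star_smul]

variable (A) in
/-- The quotient map as a *-homomorphism. -/
def mkHom : ProdAlg A →⋆ₙₐ[ℂ] QuotAlg A where
  toFun := mk A
  map_smul' := map_smul (mk A)
  map_zero' := map_zero (mk A)
  map_add' := map_add (mk A)
  map_mul' := mk_mul
  map_star' := mk_star

end QuotAlg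

/-- The direct sum `⊕ₖ Aₖ` as a C*-algebra in its own right. -/
def SumAlg : Type v := sumIdeal A

instance : NonUnitalCStarAlgebra (SumAlg A) :=
  inferInstanceAs (NonUnitalCStarAlgebra (sumIdeal A))

/-- The inclusion of the direct sum into the product. -/
def SumAlg.incl : SumAlg A →⋆ₙₐ[ℂ] ProdAlg A :=
  NonUnitalStarSubalgebraClass.subtype (sumIdeal A)

end

section MinTensor

/-- A *-representation of a C*-algebra on a Hilbert space (possibly degenerate). -/
structure CStarRep (A : Type u) [NonUnitalCStarAlgebra A] : Type (u + 1) where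
  H : Type u
  [normed : NormedAddCommGroup H]
  [inner : InnerProductSpace ℂ H]
  [complete : CompleteSpace H]
  hom : A →⋆ₙₐ[ℂ] (H →L[ℂ] H)

attribute [instance] CStarRep.normed CStarRep.inner CStarRep.complete

/-- Composition of a representation with a *-homomorphism. -/
def CStarRep.comap {A B : Type u} [NonUnitalCStarAlgebra A] [NonUnitalCStarAlgebra B]
    (φ : A →⋆ₙₐ[ℂ] B) (π : CStarRep B) : CStarRep A := ⟨π.H, π.hom.comp φ⟩

/-- The Hilbert space tensor product of the spaces of two representations. -/
abbrev CStarRep.HTensor {A : Type v} {C : Type u} [NonUnitalCStarAlgebra A] [NonUnitalCStarAlgebra C]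
    (P : CStarRep A × CStarRep C) : Type (max v u) :=
  UniformSpace.Completion (P.1.H ⊗[ℂ] P.2.H)

variable (A : Type v) (C : Type u) [NonUnitalCStarAlgebra A] [NonUnitalCStarAlgebra C]

instance (P : CStarRep A × CStarRep C) :
    NonUnitalCStarAlgebra (CStarRep.HTensor P →L[ℂ] CStarRep.HTensor P) := inferInstance

/-- The product, over all pairs of representations `(π, ρ)` of `A` and `C`, of the algebras of bounded
operators on the Hilbert space tensor products `H_π ⊗ H_ρ`. -/
def RepProd : Type (max (v + 1) (u + 1)) :=
  lp (fun P : CStarRep A × CStarRep C => CStarRep.HTensor P →L[ℂ] CStarRep.HTensor P) ∞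

instance : NonUnitalCStarAlgebra (RepProd A C) :=
  inferInstanceAs (NonUnitalCStarAlgebra
    (lp (fun P : CStarRep A × CStarRep C => CStarRep.HTensor P →L[ℂ] CStarRep.HTensor P) ∞))

variable {A C}

theorem norm_completion_le {H : Type w} [NormedAddCommGroup H] [InnerProductSpace ℂ H]
    (T : H →L[ℂ] H) : ‖T.completion‖ ≤ ‖T‖ := by
  refine ContinuousLinearMap.opNorm_le_bound _ (norm_nonneg _) fun x => ?_
  induction x using UniformSpace.Completion.induction_on with
  | hp => exact isClosed_le (by fun_prop) (by fun_prop)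
  | ih x => simpa using T.le_opNorm x

/-- The family of operators `π(a) ⊗ ρ(c)`. -/
def repTmul (a : A) (c : C) : RepProd A C :=
  ⟨fun P => (TensorProduct.mapL (P.1.hom a) (P.2.hom c)).completion, memℓp_infty ⟨‖a‖ * ‖c‖, by
    rintro _ ⟨P, rfl⟩
    refine (norm_completion_le _).trans ((TensorProduct.norm_mapL_le _ _).trans ?_)
    gcongr
    · exact NonUnitalStarAlgHom.norm_apply_le P.1.hom a
    · exact NonUnitalStarAlgHom.norm_apply_le P.2.hom c⟩⟩

variable (A C) in
/-- The closed *-subalgebra generated by the elementary tensors. For a finite sum of elementary tensors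
the norm is the minimal (spatial) norm, the supremum of `‖∑ π(aᵢ) ⊗ ρ(cᵢ)‖` over all pairs `(π, ρ)`. -/
def minSubalgebra : NonUnitalStarSubalgebra ℂ (RepProd A C) :=
  (NonUnitalStarAlgebra.adjoin ℂ
    (Set.range fun p : A × C => repTmul p.1 p.2)).topologicalClosure

instance : IsClosed (minSubalgebra A C : Set (RepProd A C)) :=
  NonUnitalStarSubalgebra.isClosed_topologicalClosure _

variable (A C) in
/-- The minimal tensor product of two C*-algebras. -/
def MinTensor : Type (max (v + 1) (u + 1)) := minSubalgebra A C

instance : NonUnitalCStarAlgebra (MinTensor A C) :=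
  inferInstanceAs (NonUnitalCStarAlgebra (minSubalgebra A C))

/-- The elementary tensor `a ⊗ c`. -/
def MinTensor.tmul (a : A) (c : C) : MinTensor A C :=
  ⟨repTmul a c, NonUnitalStarSubalgebra.le_topologicalClosure _
    (NonUnitalStarAlgebra.subset_adjoin ℂ _ ⟨(a, c), rfl⟩)⟩

variable {B : Type v} [NonUnitalCStarAlgebra B] 

variable (C) in
/-- The map `(x_(π, ρ)) ↦ (x_(π ∘ φ, ρ))`, which sends `a ⊗ c` to `φ(a) ⊗ c`. -/
def repPullback (φ : A →⋆ₙₐ[ℂ] B) : RepProd A C →⋆ₙₐ[ℂ] RepProd B C where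
  toFun x := ⟨fun P => x.1 (P.1.comap φ, P.2), memℓp_infty ⟨‖x‖, by
    rintro _ ⟨P, rfl⟩
    exact lp.norm_apply_le_norm (by simp) x (P.1.comap φ, P.2)⟩⟩
  map_smul' _ _ := rfl
  map_zero' := rfl
  map_add' _ _ := rfl
  map_mul' _ _ := rfl
  map_star' _ := rfl

theorem repPullback_repTmul (φ : A →⋆ₙₐ[ℂ] B) (a : A) (c : C) :
    repPullback C φ (repTmul a c) = repTmul (φ a) c := rfl

theorem repPullback_mem (φ : A →⋆ₙₐ[ℂ] B) (x : RepProd A C) (hx : x ∈ minSubalgebra A C) :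
    repPullback C φ x ∈ minSubalgebra B C := by
  have hcont : Continuous (repPullback C φ) := by
    refine AddMonoidHomClass.continuous_of_bound (repPullback C φ) 1 fun x => ?_
    rw [one_mul]
    exact NonUnitalStarAlgHom.norm_apply_le (repPullback C φ) x
  have hle : NonUnitalStarAlgebra.adjoin ℂ (Set.range fun p : A × C => repTmul p.1 p.2) ≤
      (minSubalgebra B C).comap (repPullback C φ) := by
    refine NonUnitalStarAlgebra.adjoin_le ?_
    rintro _ ⟨p, rfl⟩
    exact (MinTensor.tmul (φ p.1) p.2).2
  have hcl : IsClosed ((minSubalgebra B C).comap (repPullback C φ) : Set (RepProd A C)) :=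
    IsClosed.preimage hcont (inferInstance : IsClosed (minSubalgebra B C : Set (RepProd B C)))
  exact NonUnitalStarSubalgebra.topologicalClosure_minimal _ hle hcl hx

variable (C) in
/-- The *-homomorphism `φ ⊗ id` between minimal tensor products. -/
def MinTensor.map (φ : A →⋆ₙₐ[ℂ] B) : MinTensor A C →⋆ₙₐ[ℂ] MinTensor B C where
  toFun x := ⟨repPullback C φ x.1, repPullback_mem φ x.1 x.2⟩
  map_smul' c x := Subtype.ext (map_smul (repPullback C φ) c x.1)
  map_zero' := Subtype.ext (map_zero (repPullback C φ))
  map_add' x y := Subtype.ext (map_add (repPullback C φ) x.1 y.1)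
  map_mul' x y := Subtype.ext (map_mul (repPullback C φ) x.1 y.1)
  map_star' x := Subtype.ext (map_star (repPullback C φ) x.1)

theorem MinTensor.map_tmul (φ : A →⋆ₙₐ[ℂ] B) (a : A) (c : C) :
    MinTensor.map C φ (MinTensor.tmul a c) = MinTensor.tmul (φ a) c := rfl

end MinTensor

section KTheory
open Matrix

section MvN
variable {R : Type u} [Ring R] [StarRing R]

/-- Murray-von Neumann equivalence of projection matrices, of possibly different sizes. Over a
C*-algebra the last two conditions follow from the first two. -/
def MvN {m n : Type*} [Fintype m] [Fintype n] (p : Matrix m m R) (q : Matrix n n R) : Prop :=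
  ∃ v : Matrix m n R, v * vᴴ = p ∧ vᴴ * v = q ∧ p * v = v ∧ v * q = v

variable {m n l m' n' : Type*} [Fintype m] [Fintype n] [Fintype l] [Fintype m'] [Fintype n']

theorem MvN.refl {p : Matrix m m R} (hp : IsStarProjection p) : MvN p p := by
  have h1 : pᴴ = p := hp.isSelfAdjoint
  have h2 : p * p = p := hp.isIdempotentElem
  exact ⟨p, by rw [h1, h2], by rw [h1, h2], h2, h2⟩

theorem MvN.symm {p : Matrix m m R} {q : Matrix n n R} (h : MvN p q) : MvN q p := by
  obtain ⟨v, h1, h2, h3, h4⟩ := h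
  have hp : pᴴ = p := by rw [← h1]; simp
  have hq : qᴴ = q := by rw [← h2]; simp
  refine ⟨vᴴ, by simpa using h2, by simpa using h1, ?_, ?_⟩
  · simpa [hq] using congrArg conjTranspose h4
  · simpa [hp] using congrArg conjTranspose h3

theorem MvN.trans {p : Matrix m m R} {q : Matrix n n R} {r : Matrix l l R}
    (h : MvN p q) (h' : MvN q r) : MvN p r := by
  obtain ⟨v, h1, h2, h3, h4⟩ := h
  obtain ⟨w, k1, k2, k3, k4⟩ := h'
  refine ⟨v * w, ?_, ?_, ?_, ?_⟩
  · rw [conjTranspose_mul, Matrix.mul_assoc, ← Matrix.mul_assoc w, k1, ← Matrix.mul_assoc, h4, h1]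
  · rw [conjTranspose_mul, Matrix.mul_assoc, ← Matrix.mul_assoc vᴴ, h2, k3, k2]
  · rw [← Matrix.mul_assoc, h3]
  · rw [Matrix.mul_assoc, k4]

theorem MvN.reindex {p : Matrix m m R} (hp : IsStarProjection p) (e : n ≃ m) :
    MvN p (p.submatrix e e) := by
  have h1 : pᴴ = p := hp.isSelfAdjoint
  have h2 : p * p = p := hp.isIdempotentElem
  refine ⟨p.submatrix id e, ?_, ?_, ?_, ?_⟩
  · rw [conjTranspose_submatrix, submatrix_mul_equiv, h1, h2, submatrix_id_id]
  · rw [conjTranspose_submatrix, h1]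
    exact (submatrix_mul p p e id e Function.bijective_id).symm.trans (by rw [h2])
  · nth_rw 1 [← submatrix_id_id p]
    exact (submatrix_mul p p id id e Function.bijective_id).symm.trans (by rw [h2])
  · rw [submatrix_mul_equiv, h2]

theorem MvN.blocks {p : Matrix m m R} {q : Matrix n n R} {p' : Matrix m' m' R}
    {q' : Matrix n' n' R} (h : MvN p p') (h' : MvN q q') :
    MvN (fromBlocks p 0 0 q) (fromBlocks p' 0 0 q') := by
  obtain ⟨v, h1, h2, h3, h4⟩ := h
  obtain ⟨w, k1, k2, k3, k4⟩ := h'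
  refine ⟨fromBlocks v 0 0 w, ?_, ?_, ?_, ?_⟩ <;>
    simp [fromBlocks_conjTranspose, fromBlocks_multiply, h1, h2, h3, h4, k1, k2, k3, k4]

theorem MvN.zero : MvN (0 : Matrix m m R) (0 : Matrix n n R) := ⟨0, by simp⟩

theorem isStarProjection_blocks {p : Matrix m m R} {q : Matrix n n R}
    (hp : IsStarProjection p) (hq : IsStarProjection q) :
    IsStarProjection (fromBlocks p 0 0 q) := by
  have h1 : pᴴ = p := hp.isSelfAdjoint
  have h2 : p * p = p := hp.isIdempotentElem
  have k1 : qᴴ = q := hq.isSelfAdjoint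
  have k2 : q * q = q := hq.isIdempotentElem
  refine ⟨?_, ?_⟩
  · change _ * _ = _
    simp [fromBlocks_multiply, h2, k2]
  · change conjTranspose _ = _
    simp [fromBlocks_conjTranspose, h1, k1]

theorem isStarProjection_submatrix {p : Matrix m m R} (hp : IsStarProjection p) (e : n ≃ m) :
    IsStarProjection (p.submatrix e e) := by
  have h1 : pᴴ = p := hp.isSelfAdjoint
  have h2 : p * p = p := hp.isIdempotentElem
  refine ⟨?_, ?_⟩
  · change _ * _ = _
    rw [submatrix_mul_equiv, h2]
  · change conjTranspose _ = _
    rw [conjTranspose_submatrix, h1]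

variable (R) in
/-- A projection in some matrix algebra `Mₙ(R)`. -/
structure ProjMat where
  size : ℕ
  mat : Matrix (Fin size) (Fin size) R
  isProj : IsStarProjection mat

theorem ProjMat.mk_congr {k : ℕ} {p q : Matrix (Fin k) (Fin k) R} (h : p = q)
    (hp : IsStarProjection p) (hq : IsStarProjection q) :
    (⟨k, p, hp⟩ : ProjMat R) = ⟨k, q, hq⟩ := by
  subst h; rfl

instance ProjMat.setoid : Setoid (ProjMat R) where
  r p q := MvN p.mat q.mat
  iseqv := ⟨fun p => .refl p.isProj, .symm, .trans⟩

/-- The block diagonal sum of two projections. -/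
def ProjMat.sum (p q : ProjMat R) : ProjMat R where
  size := p.size + q.size
  mat := (fromBlocks p.mat 0 0 q.mat).submatrix finSumFinEquiv.symm finSumFinEquiv.symm
  isProj := isStarProjection_submatrix (isStarProjection_blocks p.isProj q.isProj) _

def ProjMat.zero : ProjMat R := ⟨0, 0, .zero _⟩

theorem ProjMat.sum_mvN (p q : ProjMat R) :
    MvN (p.sum q).mat (fromBlocks p.mat 0 0 q.mat) :=
  (MvN.reindex (isStarProjection_blocks p.isProj q.isProj) _).symm

variable (R) in
/-- Murray-von Neumann classes of projections in matrix algebras over `R`, a commutative monoid under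
block diagonal sum. -/
def ProjClass : Type u := Quotient (ProjMat.setoid (R := R))

def ProjMat.cls (p : ProjMat R) : ProjClass R := Quotient.mk _ p

instance : Add (ProjClass R) where
  add := Quotient.map₂ ProjMat.sum fun p p' h q q' h' =>
    (p.sum_mvN q).trans ((MvN.blocks h h').trans (p'.sum_mvN q').symm)

instance : Zero (ProjClass R) := ⟨ProjMat.zero.cls⟩

instance : AddCommMonoid (ProjClass R) where
  nsmul := nsmulRec
  add_assoc a b c := by
    induction a using Quotient.inductionOn with | _ p
    induction b using Quotient.inductionOn with | _ q
    induction c using Quotient.inductionOn with | _ r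
    refine Quotient.sound ?_
    have hr := MvN.reindex (isStarProjection_blocks p.isProj
      (isStarProjection_blocks q.isProj r.isProj)) (Equiv.sumAssoc _ _ _)
    have he : (fromBlocks p.mat 0 0 (fromBlocks q.mat 0 0 r.mat)).submatrix
        (Equiv.sumAssoc _ _ _) (Equiv.sumAssoc _ _ _) =
        fromBlocks (fromBlocks p.mat 0 0 q.mat) 0 0 r.mat := by
      ext ((i | i) | i) ((j | j) | j) <;> rfl
    rw [he] at hr
    exact ((p.sum q).sum_mvN r).trans ((MvN.blocks (p.sum_mvN q) (.refl r.isProj)).trans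
      (hr.symm.trans ((MvN.blocks (.refl p.isProj) (q.sum_mvN r).symm).trans
        (p.sum_mvN (q.sum r)).symm)))
  zero_add a := by
    induction a using Quotient.inductionOn with | _ p
    refine Quotient.sound ((ProjMat.zero.sum_mvN p).trans ?_)
    have hr := MvN.reindex p.isProj (Equiv.emptySum (Fin 0) (Fin p.size))
    have he : p.mat.submatrix (Equiv.emptySum (Fin 0) (Fin p.size))
        (Equiv.emptySum (Fin 0) (Fin p.size)) = fromBlocks (0 : Matrix (Fin 0) (Fin 0) R) 0 0 p.mat := by
      ext (i | i) (j | j)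
      · exact i.elim0
      · exact i.elim0
      · exact j.elim0
      · rfl
    rw [he] at hr
    exact hr.symm
  add_zero a := by
    induction a using Quotient.inductionOn with | _ p
    refine Quotient.sound ((p.sum_mvN ProjMat.zero).trans ?_)
    have hr := MvN.reindex p.isProj (Equiv.sumEmpty (Fin p.size) (Fin 0))
    have he : p.mat.submatrix (Equiv.sumEmpty (Fin p.size) (Fin 0))
        (Equiv.sumEmpty (Fin p.size) (Fin 0)) = fromBlocks p.mat 0 0 (0 : Matrix (Fin 0) (Fin 0) R) := by
      ext (i | i) (j | j)
      · rfl
      · exact j.elim0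
      · exact i.elim0
      · exact i.elim0
    rw [he] at hr
    exact hr.symm
  add_comm a b := by
    induction a using Quotient.inductionOn with | _ p
    induction b using Quotient.inductionOn with | _ q
    refine Quotient.sound ((p.sum_mvN q).trans (MvN.trans ?_ (q.sum_mvN p).symm))
    have hr := MvN.reindex (isStarProjection_blocks p.isProj q.isProj) (Equiv.sumComm _ _)
    have he : (fromBlocks p.mat 0 0 q.mat).submatrix (Equiv.sumComm _ _) (Equiv.sumComm _ _) =
        fromBlocks q.mat 0 0 p.mat := by
      ext (i | i) (j | j) <;> rfl
    rwa [he] at hr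

end MvN

section Map
variable {R S T : Type*} [Ring R] [StarRing R] [Algebra ℂ R] [Ring S] [StarRing S] [Algebra ℂ S]
  [Ring T] [StarRing T] [Algebra ℂ T]

theorem conjTranspose_map_hom (φ : R →⋆ₐ[ℂ] S) {m n : Type*} (a : Matrix m n R) :
    (a.map φ)ᴴ = aᴴ.map φ := by
  ext i j; simp [map_star]

theorem MvN.map (φ : R →⋆ₐ[ℂ] S) {m n : Type*} [Fintype m] [Fintype n] {p : Matrix m m R}
    {q : Matrix n n R} (h : MvN p q) : MvN (p.map φ) (q.map φ) := by
  obtain ⟨v, h1, h2, h3, h4⟩ := h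
  refine ⟨v.map φ, ?_, ?_, ?_, ?_⟩ <;>
    simp only [conjTranspose_map_hom, ← Matrix.map_mul, h1, h2, h3, h4]

def ProjMat.map (φ : R →⋆ₐ[ℂ] S) (p : ProjMat R) : ProjMat S where
  size := p.size
  mat := p.mat.map φ
  isProj := by
    have h1 : p.matᴴ = p.mat := p.isProj.isSelfAdjoint
    have h2 : p.mat * p.mat = p.mat := p.isProj.isIdempotentElem
    refine ⟨?_, ?_⟩
    · change _ * _ = _
      rw [← Matrix.map_mul, h2]
    · change conjTranspose _ = _
      rw [conjTranspose_map_hom, h1]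

def ProjClass.map (φ : R →⋆ₐ[ℂ] S) : ProjClass R →+ ProjClass S where
  toFun := Quotient.map (ProjMat.map φ) fun _ _ h => MvN.map φ h
  map_zero' := Quotient.sound (by
    change MvN (Matrix.map (0 : Matrix (Fin 0) (Fin 0) R) φ) (0 : Matrix (Fin 0) (Fin 0) S)
    rw [Matrix.map_zero _ (map_zero φ)]
    exact .zero)
  map_add' a b := by
    induction a using Quotient.inductionOn with | _ p
    induction b using Quotient.inductionOn with | _ q
    have he : (p.sum q).map φ = (p.map φ).sum (q.map φ) := by
      have h : ((fromBlocks p.mat 0 0 q.mat).submatrix finSumFinEquiv.symm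
          finSumFinEquiv.symm).map φ = (fromBlocks (p.mat.map φ) 0 0 (q.mat.map φ)).submatrix
          finSumFinEquiv.symm finSumFinEquiv.symm := by
        rw [← submatrix_map, fromBlocks_map, Matrix.map_zero _ (map_zero φ),
          Matrix.map_zero _ (map_zero φ)]
      exact ProjMat.mk_congr h _ _
    exact congrArg ProjMat.cls he

variable (R) in
/-- `K₀` of a unital C*-algebra: the Grothendieck group of the monoid of classes of projections. -/
def K0Unital : Type _ := Algebra.GrothendieckAddGroup (ProjClass R)

instance : AddCommGroup (K0Unital R) :=
  inferInstanceAs (AddCommGroup (Algebra.GrothendieckAddGroup (ProjClass R)))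

def K0Unital.of : ProjClass R →+ K0Unital R := Algebra.GrothendieckAddGroup.of

def K0Unital.map (φ : R →⋆ₐ[ℂ] S) : K0Unital R →+ K0Unital S :=
  Algebra.GrothendieckAddGroup.lift (K0Unital.of.comp (ProjClass.map φ))

theorem K0Unital.map_of (φ : R →⋆ₐ[ℂ] S) (x : ProjClass R) :
    K0Unital.map φ (K0Unital.of x) = K0Unital.of (ProjClass.map φ x) :=
  DFunLike.congr_fun (Algebra.GrothendieckAddGroup.lift.symm_apply_apply
    ((K0Unital.of (R := S)).comp (ProjClass.map φ))) x

theorem ProjClass.map_map (φ : R →⋆ₐ[ℂ] S) (ψ : S →⋆ₐ[ℂ] T) (x : ProjClass R) :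
    ProjClass.map ψ (ProjClass.map φ x) = ProjClass.map (ψ.comp φ) x := by
  induction x using Quotient.inductionOn with | _ p
  rfl

theorem K0Unital.hom_ext {R : Type*} [Ring R] [StarRing R] {G : Type*} [AddCommGroup G] {f g : K0Unital R →+ G}
    (h : ∀ x, f (K0Unital.of x) = g (K0Unital.of x)) : f = g :=
  Algebra.GrothendieckAddGroup.lift.symm.injective (AddMonoidHom.ext h)

theorem K0Unital.map_map (φ : R →⋆ₐ[ℂ] S) (ψ : S →⋆ₐ[ℂ] T) (x : K0Unital R) :
    K0Unital.map ψ (K0Unital.map φ x) = K0Unital.map (ψ.comp φ) x := by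
  have : (K0Unital.map ψ).comp (K0Unital.map φ) = K0Unital.map (ψ.comp φ) :=
    K0Unital.hom_ext fun x => by
      rw [AddMonoidHom.comp_apply, map_of, map_of, map_of, ProjClass.map_map]
  exact DFunLike.congr_fun this x

end Map

section NonUnital
variable (A : Type u) {B : Type v} [NonUnitalCStarAlgebra A] [NonUnitalCStarAlgebra B]

/-- The canonical character of the unitization, with kernel `A`. -/
def scalarPart : Unitization ℂ A →⋆ₐ[ℂ] ℂ where
  __ := Unitization.fstHom ℂ A
  map_star' := Unitization.fst_star

@[simp]
theorem scalarPart_apply (x : Unitization ℂ A) : scalarPart A x = x.fst := rfl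

/-- `K₀` of a C*-algebra `A`, unital or not: the kernel of the map from `K₀` of its unitization to
`K₀(ℂ)`. -/
def K0 : Type u := (K0Unital.map (scalarPart A)).ker

instance : AddCommGroup (K0 A) := inferInstanceAs (AddCommGroup (K0Unital.map (scalarPart A)).ker)

variable {A}

def K0.map (φ : A →⋆ₙₐ[ℂ] B) : K0 A →+ K0 B :=
  ((K0Unital.map (Unitization.starMap φ)).comp (K0Unital.map (scalarPart A)).ker.subtype).codRestrict
    (K0Unital.map (scalarPart B)).ker fun x => by
      have hx : K0Unital.map (scalarPart A) x.1 = 0 := x.2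
      have hc : (scalarPart B).comp (Unitization.starMap φ) = scalarPart A := by
        ext a
        simp
      rw [AddMonoidHom.mem_ker]
      change K0Unital.map (scalarPart B) (K0Unital.map (Unitization.starMap φ) x.1) = 0
      rw [K0Unital.map_map, hc, hx]

def ProjMat.ofProj (p : A) (hp : IsStarProjection p) : ProjMat (Unitization ℂ A) where
  size := 1
  mat := Matrix.of fun _ _ => (p : Unitization ℂ A)
  isProj := by
    refine ⟨?_, ?_⟩
    · change _ * _ = _
      ext i j : 1
      rw [Matrix.mul_apply]
      simp [← Unitization.inr_mul, hp.isIdempotentElem.eq]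
    · change conjTranspose _ = _
      ext i j : 1
      simp [← Unitization.inr_star, hp.isSelfAdjoint.star_eq]

/-- The class in `K₀(A)` of a projection of `A`. -/
def K0.cls (p : A) (hp : IsStarProjection p) : K0 A :=
  ⟨K0Unital.of (ProjMat.ofProj p hp).cls, by
    rw [AddMonoidHom.mem_ker, K0Unital.map_of]
    have : ProjClass.map (scalarPart A) (ProjMat.ofProj p hp).cls = 0 := by
      refine Quotient.sound ?_
      change MvN (Matrix.map (Matrix.of fun _ _ : Fin 1 => (p : Unitization ℂ A)) (scalarPart A))
        (0 : Matrix (Fin 0) (Fin 0) ℂ)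
      have h0 : Matrix.map (Matrix.of fun _ _ : Fin 1 => (p : Unitization ℂ A)) (scalarPart A) = 0 := by
        ext i j
        simp
      rw [h0]
      exact .zero
    rw [this, map_zero]⟩

variable (A) in
/-- `K₁(A)`, defined as `K₀` of the suspension `C₀(ℝ, A)`. -/
def K1 : Type u := K0 C₀(ℝ, A)

instance : AddCommGroup (K1 A) := inferInstanceAs (AddCommGroup (K0 C₀(ℝ, A)))

theorem continuous_starHom (φ : A →⋆ₙₐ[ℂ] B) : Continuous φ :=
  AddMonoidHomClass.continuous_of_bound φ 1 fun x => by
    rw [one_mul]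
    exact NonUnitalStarAlgHom.norm_apply_le φ x

/-- The map induced by `φ` between suspensions. -/
def suspMap (φ : A →⋆ₙₐ[ℂ] B) : C₀(ℝ, A) →⋆ₙₐ[ℂ] C₀(ℝ, B) where
  toFun f := ⟨⟨fun t => φ (f t), (continuous_starHom φ).comp f.continuous⟩, by
    have h := ((continuous_starHom φ).tendsto 0).comp f.zero_at_infty'
    rw [map_zero] at h
    exact h⟩
  map_smul' c f := by ext t; simp
  map_zero' := by ext t; simp
  map_add' f g := by ext t; simp
  map_mul' f g := by ext t; simp
  map_star' f := by ext t; simp [map_star]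

def K1.map (φ : A →⋆ₙₐ[ℂ] B) : K1 A →+ K1 B := K0.map (suspMap φ)

end NonUnital
end KTheory

section GroupAlgebra
variable (Γ : Type u) [Group Γ]

abbrev EllTwo : Type u := lp (fun _ : Γ => ℂ) 2

variable {Γ}

/-- The left translation operator `(λ(g)ξ)(h) = ξ(g⁻¹h)` on `ℓ²(Γ)`. -/
def leftRegular (g : Γ) : EllTwo Γ →L[ℂ] EllTwo Γ :=
  LinearIsometry.toContinuousLinearMap
  { toFun := fun ξ => ⟨fun h => ξ (g⁻¹ * h), memℓp_gen
      ((lp.memℓp ξ).summable (by norm_num) |>.comp_injective (mul_right_injective g⁻¹))⟩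
    map_add' := fun _ _ => rfl
    map_smul' := fun _ _ => rfl
    norm_map' := fun ξ => by
      rw [lp.norm_eq_tsum_rpow (by norm_num), lp.norm_eq_tsum_rpow (by norm_num)]
      congr 1
      exact (Equiv.mulLeft g⁻¹).tsum_eq fun h => ‖ξ h‖ ^ (2 : ℝ≥0∞).toReal }

variable (Γ) in
def redSubalgebra : NonUnitalStarSubalgebra ℂ (EllTwo Γ →L[ℂ] EllTwo Γ) :=
  (NonUnitalStarAlgebra.adjoin ℂ (Set.range (leftRegular (Γ := Γ)))).topologicalClosure

instance : IsClosed (redSubalgebra Γ : Set (EllTwo Γ →L[ℂ] EllTwo Γ)) :=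
  NonUnitalStarSubalgebra.isClosed_topologicalClosure _

variable (Γ) in
/-- The reduced C*-algebra of `Γ`: the norm closure of the span of the left translations on `ℓ²(Γ)`. -/
def RedGroupAlg : Type u := redSubalgebra Γ

instance : NonUnitalCStarAlgebra (RedGroupAlg Γ) :=
  inferInstanceAs (NonUnitalCStarAlgebra (redSubalgebra Γ))

/-- A group element, as an element of the reduced C*-algebra. -/
def RedGroupAlg.of (g : Γ) : RedGroupAlg Γ :=
  ⟨leftRegular g, NonUnitalStarSubalgebra.le_topologicalClosure _
    (NonUnitalStarAlgebra.subset_adjoin ℂ _ ⟨g, rfl⟩)⟩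

end GroupAlgebra

section HalfExact

/-- A C*-algebra `C` is half-K-exact if for every short exact sequence `0 → J → A → B → 0` of
C*-algebras the sequences `K_*(J ⊗ C) → K_*(A ⊗ C) → K_*(B ⊗ C)`, with minimal tensor products and
`* = 0, 1`, are exact in the middle. -/
def HalfKExact (C : Type u) [NonUnitalCStarAlgebra C] : Prop :=
  ∀ (J A B : Type v) [NonUnitalCStarAlgebra J] [NonUnitalCStarAlgebra A] [NonUnitalCStarAlgebra B]
    (α : J →⋆ₙₐ[ℂ] A) (β : A →⋆ₙₐ[ℂ] B),
    Function.Injective α → Function.Surjective β → Function.Exact α β →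
      Function.Exact (K0.map (MinTensor.map C α)) (K0.map (MinTensor.map C β)) ∧
      Function.Exact (K1.map (MinTensor.map C α)) (K1.map (MinTensor.map C β))

end HalfExact

section Expanders
variable {V : ℕ → Type v} [∀ k, Fintype (V k)] [∀ k, DecidableEq (V k)]

/-- A family of finite connected `d`-regular graphs is a family of expanders if the number of vertices
tends to infinity and the nonzero eigenvalues of the Laplacians are bounded below by a positive
constant. (By connectedness the eigenvalue `0` is simple.) -/
structure IsExpanderFamily (d : ℕ) (G : ∀ k, SimpleGraph (V k)) [∀ k, DecidableRel (G k).Adj] :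
    Prop where
  connected : ∀ k, (G k).Connected
  regular : ∀ k, (G k).IsRegularOfDegree d
  card_tendsto : Tendsto (fun k => Fintype.card (V k)) atTop atTop
  gap : ∃ ε : ℝ, 0 < ε ∧ ∀ (k : ℕ) (μ : ℝ),
    Module.End.HasEigenvalue (Matrix.toLin' ((G k).lapMatrix ℝ)) μ → μ ≠ 0 → ε ≤ μ

/-- The maps `fₖ` from the vertices of the graphs `Gₖ` to the group `Γ` form a coarse embedding, with
control functions that do not depend on `k`. Distances in `Γ` are word distances for `S`, that is,
distances in the Cayley graph with edges `g — gs`. -/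
def IsCoarseEmbeddingFamily {Γ : Type u} [Group Γ] (S : Set Γ) (G : ∀ k, SimpleGraph (V k))
    (f : ∀ k, V k → Γ) : Prop :=
  ∃ ρ₁ ρ₂ : ℝ≥0 → ℝ≥0, Tendsto ρ₁ atTop atTop ∧ Tendsto ρ₂ atTop atTop ∧
    ∀ (k : ℕ) (x y : V k),
      ρ₁ ((G k).dist x y) ≤ (SimpleGraph.mulCayley S).dist (f k x) (f k y) ∧
      (SimpleGraph.mulCayley S).dist (f k x) (f k y) ≤ ρ₂ ((G k).dist x y)

/-- The C*-algebra of complex matrices indexed by the `k`-th vertex set, with the operator norm. -/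
abbrev MatAlg (V : ℕ → Type v) (k : ℕ) : Type v := CStarMatrix (V k) (V k) ℂ

instance (k : ℕ) : NonUnitalCStarAlgebra (MatAlg V k) :=
  inferInstanceAs (NonUnitalCStarAlgebra (CStarMatrix (V k) (V k) ℂ))

/-- The map `ιₖ` with `ιₖ(E_xy) = E_xy ⊗ fₖ(x)⁻¹fₖ(y)` on matrix units, extended linearly. -/
def iotaMap {Γ : Type u} [Group Γ] (f : ∀ k, V k → Γ) (k : ℕ) (T : Matrix (V k) (V k) ℂ) :
    MinTensor (MatAlg V k) (RedGroupAlg Γ) :=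
  ∑ x, ∑ y, MinTensor.tmul (CStarMatrix.ofMatrix (Matrix.single x y (T x y)))
    (RedGroupAlg.of ((f k x)⁻¹ * f k y))

/-- The element `z` is the family `(ιₖ(Tₖ))ₖ`: its image in the `k`-th factor is `ιₖ(Tₖ)`. -/
def HasComponents {Γ : Type u} [Group Γ] (f : ∀ k, V k → Γ) (T : ∀ k, Matrix (V k) (V k) ℂ)
    (z : MinTensor (ProdAlg (MatAlg V)) (RedGroupAlg Γ)) : Prop :=
  ∀ k, MinTensor.map (RedGroupAlg Γ) (coordHom (MatAlg V) k) z = iotaMap f k (T k)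

/-- The projection on the constant functions: all the entries are equal to `1 / nₖ`. -/
def kernelProj (V : ℕ → Type v) [∀ k, Fintype (V k)] (k : ℕ) : Matrix (V k) (V k) ℂ :=
  Matrix.of fun _ _ => (Fintype.card (V k) : ℂ)⁻¹

end Expanders

end

/-! The whole argument rests on slice maps. An element of the minimal tensor product is determined
by its matrix coefficients at elementary tensors, and these can be computed by slicing either factor
first. Slicing the group factor leaves an element of `M`, which is determined by its coordinates, so
the factors `M_{n_k} ⊗ C*_r(Γ)` separate points (`eq_zero_of_map_coordHom`). Slicing the matrix
factor leaves an operator on `ℓ²(Γ)`, so for reduced group algebras the coefficients at point masses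
suffice (`eq_zero_of_inner_pointMass`).

Edges are mapped to bounded word distance and word balls are finite, so the Laplacians involve only
finitely many group elements `g`. Grouping entries by `g = f(x)⁻¹f(y)` writes `Δ` as a finite sum of
`a_g ⊗ g` with `a_g ∈ M`. Each `ι_k` is a *-homomorphism by the cocycle identity, so the spectral
gap of the graphs passes to the factors, and then to `Δ` because the factors separate points.
Functional calculus gives `1 - χ(Δ)`; its components are `ι_k(p_k)`, since connectedness makes `p_k`
the kernel projection.

The image of `q` over `M/J` is itself zero, not only its class. Slicing `q` at point masses keeps
from `p_k` only the entries with `f(x)⁻¹f(y) = g`. Fibres of a coarse embedding have at most `N`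
points, so at most `N` entries `1/n_k` remain in each row and column. By the Schur test the norm is
at most `N/n_k`, which tends to `0`, so every such slice lies in `J`.

The obstruction comes from the unnormalised traces `Tr ⊗ τ` on the factors. They take the value `1`
on every component of `q`. A class coming from `J ⊗ C*_r(Γ)` is a difference of projection matrices
over the unitization whose `k`-th components approach their scalar parts in norm; idempotents at
distance less than `1` are similar, so the trace vanishes for large `k`
(`K0.eventually_trace_map_eq_zero`). Exactness in the middle for `K₀` would contradict these two
facts about `[q]`. -/

noncomputable section

/-! ### Elementary tensors and matrix coefficients in the minimal tensor product. -/

section MinTensorBasics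
variable {A : Type v} {C : Type u} [NonUnitalCStarAlgebra A] [NonUnitalCStarAlgebra C]

theorem repTmul_ext {x y : RepProd A C} (h : ∀ P, x.1 P = y.1 P) : x = y :=
  Subtype.ext (funext h)

theorem completion_clm_ext {H K : Type*} [NormedAddCommGroup H] [InnerProductSpace ℂ H]
    [NormedAddCommGroup K] [InnerProductSpace ℂ K]
    {S T : UniformSpace.Completion H →L[ℂ] K} (h : ∀ x : H, S x = T x) : S = T := by
  ext x
  induction x using UniformSpace.Completion.induction_on with
  | hp => exact isClosed_eq S.continuous T.continuous
  | ih x => exact h x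

theorem adjoint_completion {H : Type*} [NormedAddCommGroup H] [InnerProductSpace ℂ H]
    {S T : H →L[ℂ] H} (h : ∀ x y : H, inner ℂ (S x) y = inner ℂ x (T y)) :
    ContinuousLinearMap.adjoint T.completion = S.completion := by
  symm
  rw [ContinuousLinearMap.eq_adjoint_iff]
  intro x y
  induction x, y using UniformSpace.Completion.induction_on₂ with
  | hp => exact isClosed_eq (by fun_prop) (by fun_prop)
  | ih x y => simpa using h x y

theorem inner_mapL_eq {H K : Type*} [NormedAddCommGroup H] [InnerProductSpace ℂ H]
    [NormedAddCommGroup K] [InnerProductSpace ℂ K] [CompleteSpace H] [CompleteSpace K]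
    (S : H →L[ℂ] H) (T : K →L[ℂ] K) (x y : H ⊗[ℂ] K) :
    inner ℂ (TensorProduct.mapL (star S) (star T) x) y = inner ℂ x (TensorProduct.mapL S T y) := by
  induction x using TensorProduct.induction_on with
  | zero => simp
  | add a b ha hb => simp [inner_add_left, ha, hb, -TensorProduct.mapL_apply]
  | tmul a b =>
    induction y using TensorProduct.induction_on with
    | zero => simp
    | add a b ha hb => simp [inner_add_right, ha, hb, -TensorProduct.mapL_apply]
    | tmul c d =>
      simp [ContinuousLinearMap.star_eq_adjoint, ContinuousLinearMap.adjoint_inner_left]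

theorem repTmul_add_left (a b : A) (c : C) : repTmul (a + b) c = repTmul a c + repTmul b c :=
  repTmul_ext fun P => completion_clm_ext fun x => by
    change (TensorProduct.mapL (P.1.hom (a + b)) (P.2.hom c)).completion x =
      ((TensorProduct.mapL (P.1.hom a) (P.2.hom c)).completion +
      (TensorProduct.mapL (P.1.hom b) (P.2.hom c)).completion) x
    simp [TensorProduct.mapL_add_left, -TensorProduct.mapL_apply, UniformSpace.Completion.coe_add]

theorem repTmul_smul_left (r : ℂ) (a : A) (c : C) : repTmul (r • a) c = r • repTmul a c :=
  repTmul_ext fun P => completion_clm_ext fun x => by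
    change (TensorProduct.mapL (P.1.hom (r • a)) (P.2.hom c)).completion x =
      (r • (TensorProduct.mapL (P.1.hom a) (P.2.hom c)).completion) x
    simp [TensorProduct.mapL_smul_left, -TensorProduct.mapL_apply, UniformSpace.Completion.coe_smul]

theorem repTmul_mul (a b : A) (c d : C) : repTmul a c * repTmul b d = repTmul (a * b) (c * d) :=
  repTmul_ext fun P => completion_clm_ext fun x => by
    change ((TensorProduct.mapL (P.1.hom a) (P.2.hom c)).completion *
      (TensorProduct.mapL (P.1.hom b) (P.2.hom d)).completion) x =
      (TensorProduct.mapL (P.1.hom (a * b)) (P.2.hom (c * d))).completion x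
    simp [TensorProduct.mapL_mul, -TensorProduct.mapL_apply]

theorem star_repTmul (a : A) (c : C) : star (repTmul a c) = repTmul (star a) (star c) :=
  repTmul_ext fun P => by
    change ContinuousLinearMap.adjoint (TensorProduct.mapL (P.1.hom a) (P.2.hom c)).completion =
      (TensorProduct.mapL (P.1.hom (star a)) (P.2.hom (star c))).completion
    rw [map_star, map_star]
    exact adjoint_completion (inner_mapL_eq _ _)

namespace MinTensor

theorem tmul_add_left (a b : A) (c : C) : tmul (a + b) c = tmul a c + tmul b c :=
  Subtype.ext (repTmul_add_left a b c)

theorem tmul_smul_left (r : ℂ) (a : A) (c : C) : tmul (r • a) c = r • tmul a c :=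
  Subtype.ext (repTmul_smul_left r a c)

theorem tmul_mul (a b : A) (c d : C) : tmul a c * tmul b d = tmul (a * b) (c * d) :=
  Subtype.ext (repTmul_mul a b c d)

theorem star_tmul (a : A) (c : C) : star (tmul a c) = tmul (star a) (star c) :=
  Subtype.ext (star_repTmul a c)

/-- Elementary tensors with a fixed second factor, as a linear map. -/
def tmulRight (c : C) : A →ₗ[ℂ] MinTensor A C where
  toFun a := tmul a c
  map_add' a b := tmul_add_left a b c
  map_smul' r a := tmul_smul_left r a c

theorem tmul_zero_left (c : C) : tmul (0 : A) c = 0 := map_zero (tmulRight c)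

theorem tmul_sum_left {ι : Type*} (s : Finset ι) (a : ι → A) (c : C) :
    tmul (∑ i ∈ s, a i) c = ∑ i ∈ s, tmul (a i) c := map_sum (tmulRight c) a s

theorem norm_tmul_le (a : A) (c : C) : ‖tmul a c‖ ≤ ‖a‖ * ‖c‖ := by
  refine lp.norm_le_of_forall_le (by positivity) fun P => ?_
  refine (norm_completion_le _).trans ((TensorProduct.norm_mapL_le _ _).trans ?_)
  gcongr
  · exact NonUnitalStarAlgHom.norm_apply_le P.1.hom a
  · exact NonUnitalStarAlgHom.norm_apply_le P.2.hom c

/-- The sums of elementary tensors, as a *-subalgebra. -/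
def algebraicTensors (A : Type v) (C : Type u) [NonUnitalCStarAlgebra A] [NonUnitalCStarAlgebra C] :
    NonUnitalStarSubalgebra ℂ (RepProd A C) where
  __ := AddSubmonoid.closure (Set.range fun p : A × C => repTmul p.1 p.2)
  mul_mem' {x y} hx hy := by
    change x * y ∈ AddSubmonoid.closure _
    induction hx, hy using AddSubmonoid.closure_induction₂ with
    | mem x y hx hy =>
      obtain ⟨p, rfl⟩ := hx
      obtain ⟨q, rfl⟩ := hy
      exact AddSubmonoid.subset_closure ⟨(p.1 * q.1, p.2 * q.2), (repTmul_mul _ _ _ _).symm⟩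
    | zero_left => rw [zero_mul]; exact zero_mem _
    | zero_right => rw [mul_zero]; exact zero_mem _
    | add_left _ _ _ _ _ _ h1 h2 => rw [add_mul]; exact add_mem h1 h2
    | add_right _ _ _ _ _ _ h1 h2 => rw [mul_add]; exact add_mem h1 h2
  smul_mem' r x hx := by
    change r • x ∈ AddSubmonoid.closure _
    induction hx using AddSubmonoid.closure_induction with
    | mem x hx =>
      obtain ⟨p, rfl⟩ := hx
      exact AddSubmonoid.subset_closure ⟨(r • p.1, p.2), repTmul_smul_left _ _ _⟩
    | zero => rw [smul_zero]; exact zero_mem _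
    | add _ _ _ _ h1 h2 => rw [smul_add]; exact add_mem h1 h2
  star_mem' {x} hx := by
    change star x ∈ AddSubmonoid.closure _
    induction hx using AddSubmonoid.closure_induction with
    | mem x hx =>
      obtain ⟨p, rfl⟩ := hx
      exact AddSubmonoid.subset_closure ⟨(star p.1, star p.2), (star_repTmul _ _).symm⟩
    | zero => rw [star_zero]; exact zero_mem _
    | add _ _ _ _ h1 h2 => rw [star_add]; exact add_mem h1 h2

/-- Sums of elementary tensors already form a *-subalgebra, so the generated *-subalgebra lies in
them and they are dense. Identities between continuous additive maps therefore need checking only on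
elementary tensors. -/
theorem induction_on {p : MinTensor A C → Prop} (z : MinTensor A C) (closed : IsClosed {z | p z})
    (tmul : ∀ a c, p (tmul a c)) (add : ∀ x y, p x → p y → p (x + y)) : p z := by
  have hle : NonUnitalStarAlgebra.adjoin ℂ (Set.range fun p : A × C => repTmul p.1 p.2) ≤
      algebraicTensors A C :=
    NonUnitalStarAlgebra.adjoin_le AddSubmonoid.subset_closure
  have hmem : ∀ x ∈ AddSubmonoid.closure (Set.range fun p : A × C => repTmul p.1 p.2),
      ∃ w : MinTensor A C, w.1 = x ∧ p w := by
    intro x hx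
    induction hx using AddSubmonoid.closure_induction with
    | mem x hx =>
      obtain ⟨q, rfl⟩ := hx
      exact ⟨_, rfl, tmul q.1 q.2⟩
    | zero => exact ⟨0, rfl, by simpa [tmul_zero_left] using tmul 0 0⟩
    | add _ _ _ _ h1 h2 =>
      obtain ⟨w, rfl, hw⟩ := h1
      obtain ⟨w', rfl, hw'⟩ := h2
      exact ⟨w + w', rfl, add _ _ hw hw'⟩
  have hz : z ∈ closure {z : MinTensor A C | p z} := by
    refine closure_subtype.2 (closure_mono (fun x hx => ?_) z.2)
    obtain ⟨w, rfl, hw⟩ := hmem x (hle hx)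
    exact ⟨w, hw, rfl⟩
  exact closed.closure_subset hz

/-- The operator `(π ⊗ ρ)(z)`. -/
def rep (P : CStarRep A × CStarRep C) :
    MinTensor A C →⋆ₙₐ[ℂ] (CStarRep.HTensor P →L[ℂ] CStarRep.HTensor P) where
  toFun z := z.1.1 P
  map_smul' _ _ := rfl
  map_zero' := rfl
  map_add' _ _ := rfl
  map_mul' _ _ := rfl
  map_star' _ := rfl

theorem ext_rep {z w : MinTensor A C} (h : ∀ P, rep P z = rep P w) : z = w :=
  Subtype.ext (repTmul_ext h)

theorem continuous_rep (P : CStarRep A × CStarRep C) : Continuous (rep P) :=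
  continuous_starHom _

end MinTensor

namespace CStarRep
variable (P : CStarRep A × CStarRep C)

/-- The bounded operator `ξ ↦ ξ ⊗ η`. -/
def tensR (η : P.2.H) : P.1.H →L[ℂ] HTensor P :=
  UniformSpace.Completion.toComplL.comp ((TensorProduct.mkL ℂ P.1.H P.2.H).flip η)

/-- The bounded operator `η ↦ ξ ⊗ η`. -/
def tensL (ξ : P.1.H) : P.2.H →L[ℂ] HTensor P :=
  UniformSpace.Completion.toComplL.comp (TensorProduct.mkL ℂ P.1.H P.2.H ξ)

theorem tensR_apply (ξ : P.1.H) (η : P.2.H) :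
    tensR P η ξ = ((ξ ⊗ₜ[ℂ] η : P.1.H ⊗[ℂ] P.2.H) : HTensor P) := rfl

theorem tensL_apply (ξ : P.1.H) (η : P.2.H) : tensL P ξ η = tensR P η ξ := rfl

theorem inner_tensR (ξ ξ' : P.1.H) (η η' : P.2.H) :
    Inner.inner ℂ (tensR P η ξ) (tensR P η' ξ') = Inner.inner ℂ ξ ξ' * Inner.inner ℂ η η' := by
  rw [tensR_apply, tensR_apply, UniformSpace.Completion.inner_coe, TensorProduct.inner_tmul]

theorem norm_tensR_le (η : P.2.H) : ‖tensR P η‖ ≤ ‖η‖ :=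
  ContinuousLinearMap.opNorm_le_bound _ (norm_nonneg _) fun ξ => by
    rw [tensR_apply, UniformSpace.Completion.norm_coe, TensorProduct.norm_tmul, mul_comm]

theorem rep_tmul_tensR (a : A) (c : C) (ξ : P.1.H) (η : P.2.H) :
    MinTensor.rep P (MinTensor.tmul a c) (tensR P η ξ) = tensR P (P.2.hom c η) (P.1.hom a ξ) := by
  change (TensorProduct.mapL (P.1.hom a) (P.2.hom c)).completion _ = _
  rw [tensR_apply, tensR_apply]
  simp

/-- A bounded operator on the tensor product is zero if its matrix coefficients between elementary
tensors from total sets of vectors vanish. -/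
theorem clm_eq_zero {T : HTensor P →L[ℂ] HTensor P}
    (h : ∀ ξ ξ' η η', Inner.inner ℂ (tensR P η' ξ') (T (tensR P η ξ)) = 0) : T = 0 := by
  refine completion_clm_ext fun x => ?_
  rw [zero_apply]
  refine ext_inner_left ℂ fun y => ?_
  rw [inner_zero_right]
  induction y using UniformSpace.Completion.induction_on with
  | hp => exact isClosed_eq (by fun_prop) (by fun_prop)
  | ih y =>
    induction y using TensorProduct.induction_on with
    | zero => change Inner.inner ℂ ((0 : P.1.H ⊗[ℂ] P.2.H) : HTensor P) _ = 0; rw [UniformSpace.Completion.coe_zero, inner_zero_left]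
    | add a b ha hb => rw [UniformSpace.Completion.coe_add, inner_add_left, ha, hb, add_zero]
    | tmul ξ' η' =>
      induction x using TensorProduct.induction_on with
      | zero => change Inner.inner ℂ _ (T ((0 : P.1.H ⊗[ℂ] P.2.H) : HTensor P)) = 0; rw [UniformSpace.Completion.coe_zero, map_zero, inner_zero_right]
      | add a b ha hb => rw [UniformSpace.Completion.coe_add, map_add, inner_add_right, ha, hb, add_zero]
      | tmul ξ η => exact h ξ ξ' η η'

end CStarRep
end MinTensorBasics

/-! ### Slice maps, and separation of points by the matrix factors. -/

section Slices
variable {C : Type u} [NonUnitalCStarAlgebra C]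
variable {V : ℕ → Type v} [∀ k, Fintype (V k)] [∀ k, DecidableEq (V k)]

/-- Matrices act on Euclidean space. -/
def matEquiv (V : ℕ → Type v) [∀ k, Fintype (V k)] [∀ k, DecidableEq (V k)] (k : ℕ) :
    CStarMatrix (V k) (V k) ℂ ≃⋆ₐ[ℂ] (EuclideanSpace ℂ (V k) →L[ℂ] EuclideanSpace ℂ (V k)) :=
  CStarMatrix.ofMatrixStarAlgEquiv.symm.trans Matrix.toEuclideanCLM

/-- The action of matrices on Euclidean space, as a *-homomorphism of C*-algebras. -/
def matHom (V : ℕ → Type v) [∀ k, Fintype (V k)] [∀ k, DecidableEq (V k)] (k : ℕ) :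
    MatAlg V k →⋆ₙₐ[ℂ] (EuclideanSpace ℂ (V k) →L[ℂ] EuclideanSpace ℂ (V k)) where
  toFun := matEquiv V k
  map_smul' r x := map_smul (matEquiv V k) r x
  map_zero' := map_zero (matEquiv V k)
  map_add' x y := map_add (matEquiv V k) x y
  map_mul' x y := map_mul (matEquiv V k) x y
  map_star' x := map_star (matEquiv V k) x

/-- Injective *-homomorphisms of C*-algebras are isometric; this lets norms of matrices be computed
on Euclidean space. -/
theorem norm_matHom (k : ℕ) (a : MatAlg V k) : ‖matHom V k a‖ = ‖a‖ :=
  NonUnitalStarAlgHom.norm_map (matHom V k) (matEquiv V k).injective a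

/-- The matrix of an operator on Euclidean space. -/
def matOf (V : ℕ → Type v) [∀ k, Fintype (V k)] [∀ k, DecidableEq (V k)] (k : ℕ) :
    (EuclideanSpace ℂ (V k) →L[ℂ] EuclideanSpace ℂ (V k)) →ₗ[ℂ] MatAlg V k where
  toFun := (matEquiv V k).symm
  map_add' := map_add (matEquiv V k).symm
  map_smul' := map_smul (matEquiv V k).symm

theorem matHom_matOf (k : ℕ) (T : EuclideanSpace ℂ (V k) →L[ℂ] EuclideanSpace ℂ (V k)) :
    matHom V k (matOf V k T) = T := (matEquiv V k).apply_symm_apply T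

theorem matOf_matHom (k : ℕ) (a : MatAlg V k) : matOf V k (matHom V k a) = a :=
  (matEquiv V k).symm_apply_apply a

theorem norm_matOf (k : ℕ) (T : EuclideanSpace ℂ (V k) →L[ℂ] EuclideanSpace ℂ (V k)) :
    ‖matOf V k T‖ = ‖T‖ := by
  rw [← norm_matHom, matHom_matOf]

/-- The standard representation of a matrix algebra. -/
abbrev stdRep (V : ℕ → Type v) [∀ k, Fintype (V k)] [∀ k, DecidableEq (V k)] (k : ℕ) :
    CStarRep (MatAlg V k) where
  H := EuclideanSpace ℂ (V k)
  hom := matHom V k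

/-- The standard representation of the `k`-th factor of a product of matrix algebras. -/
abbrev coordRep (V : ℕ → Type v) [∀ k, Fintype (V k)] [∀ k, DecidableEq (V k)] (k : ℕ) :
    CStarRep (ProdAlg (MatAlg V)) where
  H := EuclideanSpace ℂ (V k)
  hom := (matHom V k).comp (coordHom (MatAlg V) k)

theorem MinTensor.norm_rep_le {A : Type v} [NonUnitalCStarAlgebra A]
    (P : CStarRep A × CStarRep C) (z : MinTensor A C) : ‖rep P z‖ ≤ ‖z‖ :=
  NonUnitalStarAlgHom.norm_apply_le _ z

theorem CStarRep.adjoint_tensR_tensR {A : Type v} [NonUnitalCStarAlgebra A]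
    (P : CStarRep A × CStarRep C) (η η' : P.2.H) (ξ : P.1.H) :
    ContinuousLinearMap.adjoint (tensR P η') (tensR P η ξ) = (Inner.inner ℂ η' η : ℂ) • ξ := by
  refine ext_inner_left ℂ fun ζ => ?_
  rw [ContinuousLinearMap.adjoint_inner_right, inner_tensR, inner_smul_right, mul_comm]

theorem CStarRep.adjoint_tensL_tensR {A : Type v} [NonUnitalCStarAlgebra A]
    (P : CStarRep A × CStarRep C) (η : P.2.H) (ξ ξ' : P.1.H) :
    ContinuousLinearMap.adjoint (tensL P ξ') (tensR P η ξ) = (Inner.inner ℂ ξ' ξ : ℂ) • η := by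
  refine ext_inner_left ℂ fun ζ => ?_
  rw [ContinuousLinearMap.adjoint_inner_right, tensL_apply, inner_tensR, inner_smul_right]

/-- Slicing the second tensor factor of `(π ⊗ ρ)(z)`: the map `a ⊗ c ↦ ⟨η', ρ(c)η⟩ π(a)`. -/
def sliceR {A : Type v} [NonUnitalCStarAlgebra A] (P : CStarRep A × CStarRep C) (η η' : P.2.H) :
    MinTensor A C →ₗ[ℂ] (P.1.H →L[ℂ] P.1.H) where
  toFun z := (ContinuousLinearMap.adjoint (CStarRep.tensR P η')).comp
    ((MinTensor.rep P z).comp (CStarRep.tensR P η))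
  map_add' z w := by simp only [map_add, ContinuousLinearMap.add_comp, ContinuousLinearMap.comp_add]
  map_smul' r z := by
    simp only [map_smul, ContinuousLinearMap.smul_comp, ContinuousLinearMap.comp_smul, RingHom.id_apply]

/-- Slicing the first tensor factor of `(π ⊗ ρ)(z)`: the map `a ⊗ c ↦ ⟨ξ', π(a)ξ⟩ ρ(c)`. -/
def sliceL {A : Type v} [NonUnitalCStarAlgebra A] (P : CStarRep A × CStarRep C) (ξ ξ' : P.1.H) :
    MinTensor A C →ₗ[ℂ] (P.2.H →L[ℂ] P.2.H) where
  toFun z := (ContinuousLinearMap.adjoint (CStarRep.tensL P ξ')).comp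
    ((MinTensor.rep P z).comp (CStarRep.tensL P ξ))
  map_add' z w := by simp only [map_add, ContinuousLinearMap.add_comp, ContinuousLinearMap.comp_add]
  map_smul' r z := by
    simp only [map_smul, ContinuousLinearMap.smul_comp, ContinuousLinearMap.comp_smul, RingHom.id_apply]

section
variable {A : Type v} [NonUnitalCStarAlgebra A] (P : CStarRep A × CStarRep C)

theorem norm_sliceR_le (η η' : P.2.H) (z : MinTensor A C) :
    ‖sliceR P η η' z‖ ≤ ‖η'‖ * ‖η‖ * ‖z‖ := by
  refine (ContinuousLinearMap.opNorm_comp_le _ _).trans ?_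
  rw [LinearIsometryEquiv.norm_map]
  calc _ ≤ ‖CStarRep.tensR P η'‖ * (‖MinTensor.rep P z‖ * ‖CStarRep.tensR P η‖) := by
        gcongr; exact ContinuousLinearMap.opNorm_comp_le _ _
    _ ≤ ‖η'‖ * (‖z‖ * ‖η‖) := by
        gcongr
        · exact CStarRep.norm_tensR_le _ _
        · exact MinTensor.norm_rep_le P z
        · exact CStarRep.norm_tensR_le _ _
    _ = _ := by ring

theorem sliceR_tmul (η η' : P.2.H) (a : A) (c : C) :
    sliceR P η η' (MinTensor.tmul a c) = (inner ℂ η' (P.2.hom c η) : ℂ) • P.1.hom a := by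
  ext1 ξ
  change ContinuousLinearMap.adjoint (CStarRep.tensR P η')
    (MinTensor.rep P (MinTensor.tmul a c) (CStarRep.tensR P η ξ)) = _
  rw [CStarRep.rep_tmul_tensR, CStarRep.adjoint_tensR_tensR]
  rfl

theorem continuous_sliceL (ξ ξ' : P.1.H) : Continuous (sliceL P ξ ξ') := by
  have h1 : Continuous (MinTensor.rep P) := MinTensor.continuous_rep _
  change Continuous fun z => (ContinuousLinearMap.adjoint (CStarRep.tensL P ξ')).comp
    ((MinTensor.rep P z).comp (CStarRep.tensL P ξ))
  exact continuous_const.clm_comp (h1.clm_comp continuous_const)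

theorem sliceL_tmul (ξ ξ' : P.1.H) (a : A) (c : C) :
    sliceL P ξ ξ' (MinTensor.tmul a c) = (inner ℂ ξ' (P.1.hom a ξ) : ℂ) • P.2.hom c := by
  ext1 η
  change ContinuousLinearMap.adjoint (CStarRep.tensL P ξ')
    (MinTensor.rep P (MinTensor.tmul a c) (CStarRep.tensR P η ξ)) = _
  rw [CStarRep.rep_tmul_tensR, CStarRep.adjoint_tensL_tensR]
  rfl

theorem inner_sliceL (η η' : P.2.H) (ξ ξ' : P.1.H) (z : MinTensor A C) :
    (inner ℂ η' (sliceL P ξ ξ' z η) : ℂ) =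
      inner ℂ (CStarRep.tensR P η' ξ') (MinTensor.rep P z (CStarRep.tensR P η ξ)) := by
  change (inner ℂ η' (ContinuousLinearMap.adjoint (CStarRep.tensL P ξ')
    (MinTensor.rep P z (CStarRep.tensL P ξ η))) : ℂ) = _
  rw [ContinuousLinearMap.adjoint_inner_right]
  rfl

theorem sliceR_eq_zero (η η' : P.2.H) {z : MinTensor A C} (h : MinTensor.rep P z = 0) :
    sliceR P η η' z = 0 := by
  change (ContinuousLinearMap.adjoint (CStarRep.tensR P η')).comp
    ((MinTensor.rep P z).comp (CStarRep.tensR P η)) = 0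
  rw [h, ContinuousLinearMap.zero_comp, ContinuousLinearMap.comp_zero]

end

/-- The slice map `a ⊗ c ↦ ⟨η', ρ(c)η⟩ a`. -/
def matSlice (ρ : CStarRep C) (η η' : ρ.H) :
    MinTensor (ProdAlg (MatAlg V)) C →L[ℂ] ProdAlg (MatAlg V) :=
  LinearMap.mkContinuous
    { toFun := fun z => ⟨fun k => matOf V k (sliceR (coordRep V k, ρ) η η' z),
        memℓp_infty ⟨‖η'‖ * ‖η‖ * ‖z‖, by
          rintro _ ⟨k, rfl⟩
          exact (norm_matOf k _).trans_le (norm_sliceR_le (coordRep V k, ρ) η η' z)⟩⟩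
      map_add' := fun z w => by
        refine Subtype.ext (funext fun k => ?_)
        change matOf V k (sliceR (coordRep V k, ρ) η η' (z + w)) =
          matOf V k (sliceR (coordRep V k, ρ) η η' z) + matOf V k (sliceR (coordRep V k, ρ) η η' w)
        rw [map_add]; exact map_add (matOf V k) _ _
      map_smul' := fun r z => by
        refine Subtype.ext (funext fun k => ?_)
        change matOf V k (sliceR (coordRep V k, ρ) η η' (r • z)) =
          r • matOf V k (sliceR (coordRep V k, ρ) η η' z)
        rw [map_smul]; exact map_smul (matOf V k) _ _ }
    (‖η'‖ * ‖η‖) fun z => by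
      refine lp.norm_le_of_forall_le (by positivity) fun k => ?_
      exact (norm_matOf k _).trans_le (norm_sliceR_le (coordRep V k, ρ) η η' z)

theorem matSlice_apply (ρ : CStarRep C) (η η' : ρ.H) (z : MinTensor (ProdAlg (MatAlg V)) C) (k : ℕ) :
    matSlice ρ η η' z k = matOf V k (sliceR (coordRep V k, ρ) η η' z) := rfl

theorem matSlice_tmul (ρ : CStarRep C) (η η' : ρ.H) (a : ProdAlg (MatAlg V)) (c : C) :
    matSlice ρ η η' (MinTensor.tmul a c) = (inner ℂ η' (ρ.hom c η) : ℂ) • a := by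
  refine Subtype.ext (funext fun k => ?_)
  change matSlice ρ η η' (MinTensor.tmul a c) k = (inner ℂ η' (ρ.hom c η) : ℂ) • (a k)
  rw [matSlice_apply, sliceR_tmul]
  refine (map_smul (matOf V k) _ _).trans ?_
  exact congrArg _ (matOf_matHom k (a k))

/-- Both sides are continuous and linear in `z` and agree on elementary tensors. The point is that
the slice uses only the coordinate representations, whereas `P.1` is an arbitrary representation of
the product, possibly one that kills the direct sum. -/
theorem inner_rep_eq_matSlice (P : CStarRep (ProdAlg (MatAlg V)) × CStarRep C)
    (z : MinTensor (ProdAlg (MatAlg V)) C) (ξ ξ' : P.1.H) (η η' : P.2.H) :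
    (inner ℂ (CStarRep.tensR P η' ξ') (MinTensor.rep P z (CStarRep.tensR P η ξ)) : ℂ) =
      inner ℂ ξ' (P.1.hom (matSlice P.2 η η' z) ξ) := by
  induction z using MinTensor.induction_on with
  | closed =>
    have h1 : Continuous (MinTensor.rep P) := MinTensor.continuous_rep P
    have h2 : Continuous P.1.hom := continuous_starHom _
    exact isClosed_eq (by fun_prop) (by fun_prop)
  | tmul a c =>
    rw [CStarRep.rep_tmul_tensR, CStarRep.inner_tensR, matSlice_tmul, map_smul,
      smul_apply, inner_smul_right, mul_comm]
  | add x y hx hy => simp only [map_add, add_apply, inner_add_right, hx, hy]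

/-- The coordinate maps separate the points of the minimal tensor product. -/
theorem eq_zero_of_map_coordHom (z : MinTensor (ProdAlg (MatAlg V)) C)
    (h : ∀ k, MinTensor.map C (coordHom (MatAlg V) k) z = 0) : z = 0 := by
  refine MinTensor.ext_rep fun P => ?_
  rw [map_zero]
  refine CStarRep.clm_eq_zero P fun ξ ξ' η η' => ?_
  -- The `k`-th entry of the slice is computed in a representation that factors through the `k`-th
  -- coordinate map, where `z` vanishes by hypothesis.
  have : matSlice P.2 η η' z = 0 := by
    refine Subtype.ext (funext fun k => ?_)
    change matSlice P.2 η η' z k = 0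
    have h0 : MinTensor.rep (coordRep V k, P.2) z = 0 := by
      change MinTensor.rep (stdRep V k, P.2) (MinTensor.map C (coordHom (MatAlg V) k) z) = 0
      rw [h, map_zero]
    rw [matSlice_apply, sliceR_eq_zero _ _ _ h0]
    exact map_zero (matOf V k)
  rw [inner_rep_eq_matSlice, this, map_zero, zero_apply, inner_zero_right]

theorem eq_of_map_coordHom {z w : MinTensor (ProdAlg (MatAlg V)) C}
    (h : ∀ k, MinTensor.map C (coordHom (MatAlg V) k) z = MinTensor.map C (coordHom (MatAlg V) k) w) :
    z = w :=
  sub_eq_zero.1 (eq_zero_of_map_coordHom _ fun k => by rw [map_sub, h, sub_self])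

end Slices

/-! ### Slicing down to the reduced group algebra; point masses. -/

section RegularSlice
variable {Γ : Type u} [Group Γ] {A : Type v} [NonUnitalCStarAlgebra A]

variable (Γ) in
/-- The regular representation. -/
abbrev regRep : CStarRep (RedGroupAlg Γ) where
  H := EllTwo Γ
  hom := (NonUnitalStarSubalgebraClass.subtype (redSubalgebra Γ) : redSubalgebra Γ →⋆ₙₐ[ℂ] _)

/-- An elementary tensor slices to a multiple of its second factor, and the reduced algebra is a
closed subspace. Membership is needed so that an arbitrary representation of the algebra can be
applied to the slice. -/
theorem sliceL_mem (π : CStarRep A) (ξ ξ' : π.H) (z : MinTensor A (RedGroupAlg Γ)) :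
    sliceL (π, regRep Γ) ξ ξ' z ∈ redSubalgebra Γ := by
  induction z using MinTensor.induction_on with
  | closed =>
    exact IsClosed.preimage (continuous_sliceL (π, regRep Γ) ξ ξ')
      (inferInstance : IsClosed (redSubalgebra Γ : Set (EllTwo Γ →L[ℂ] EllTwo Γ)))
  | tmul a c => rw [sliceL_tmul]; exact SMulMemClass.smul_mem _ c.2
  | add x y hx hy => rw [map_add]; exact add_mem hx hy

/-- The slice map `a ⊗ c ↦ ⟨ξ', π(a)ξ⟩ c`. -/
def regSlice (π : CStarRep A) (ξ ξ' : π.H) (z : MinTensor A (RedGroupAlg Γ)) : RedGroupAlg Γ :=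
  ⟨sliceL (π, regRep Γ) ξ ξ' z, sliceL_mem π ξ ξ' z⟩

theorem continuous_regSlice (π : CStarRep A) (ξ ξ' : π.H) :
    Continuous (regSlice (Γ := Γ) π ξ ξ') :=
  (continuous_sliceL (π, regRep Γ) ξ ξ').subtype_mk _

theorem regSlice_tmul (π : CStarRep A) (ξ ξ' : π.H) (a : A) (c : RedGroupAlg Γ) :
    regSlice π ξ ξ' (MinTensor.tmul a c) = (inner ℂ ξ' (π.hom a ξ) : ℂ) • c :=
  Subtype.ext (sliceL_tmul (π, regRep Γ) ξ ξ' a c)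

theorem regSlice_add (π : CStarRep A) (ξ ξ' : π.H) (z w : MinTensor A (RedGroupAlg Γ)) :
    regSlice π ξ ξ' (z + w) = regSlice π ξ ξ' z + regSlice π ξ ξ' w :=
  Subtype.ext (map_add (sliceL (π, regRep Γ) ξ ξ') z w)

/-- The slice is formed in the regular representation but controls every representation `P.2` of the
reduced algebra: both sides are continuous, linear, and equal on elementary tensors. -/
theorem inner_rep_eq_regSlice (P : CStarRep A × CStarRep (RedGroupAlg Γ))
    (z : MinTensor A (RedGroupAlg Γ)) (ξ ξ' : P.1.H) (η η' : P.2.H) :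
    (inner ℂ (CStarRep.tensR P η' ξ') (MinTensor.rep P z (CStarRep.tensR P η ξ)) : ℂ) =
      inner ℂ η' (P.2.hom (regSlice P.1 ξ ξ' z) η) := by
  induction z using MinTensor.induction_on with
  | closed =>
    have h1 : Continuous (MinTensor.rep P) := MinTensor.continuous_rep P
    have h2 : Continuous P.2.hom := continuous_starHom _
    have h3 : Continuous fun z => regSlice (Γ := Γ) P.1 ξ ξ' z := continuous_regSlice P.1 ξ ξ'
    exact isClosed_eq (by fun_prop) (by fun_prop)
  | tmul a c =>
    rw [CStarRep.rep_tmul_tensR, CStarRep.inner_tensR, regSlice_tmul, map_smul, smul_apply,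
      inner_smul_right]
  | add x y hx hy => simp only [map_add, add_apply, inner_add_right, hx, hy, regSlice_add]

/-- The point mass at `g`. -/
def pointMass {Γ : Type u} (g : Γ) : EllTwo Γ := by
  classical exact lp.single 2 g 1

open scoped Classical in
theorem pointMass_apply {Γ : Type u} (g h : Γ) :
    (pointMass g) h = if h = g then 1 else 0 := by
  rw [pointMass, lp.single_apply]
  by_cases hh : h = g
  · subst hh; simp
  · simp [hh]

theorem inner_pointMass {Γ : Type u} (g : Γ) (ξ : EllTwo Γ) : (inner ℂ (pointMass g) ξ : ℂ) = ξ g := by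
  classical
  rw [pointMass]
  simpa using lp.inner_single_left (𝕜 := ℂ) g (1 : ℂ) ξ

theorem leftRegular_pointMass (g h : Γ) : leftRegular g (pointMass h) = pointMass (g * h) := by
  classical
  refine Subtype.ext (funext fun x => ?_)
  change (pointMass h) (g⁻¹ * x) = (pointMass (g * h)) x
  rw [pointMass_apply, pointMass_apply, inv_mul_eq_iff_eq_mul]

theorem clm_ext_pointMass {Γ : Type u} {T : EllTwo Γ →L[ℂ] EllTwo Γ} (h : ∀ g, T (pointMass g) = 0) : T = 0 := by
  classical
  ext1 ξ
  have h1 := (lp.hasSum_single (by norm_num) ξ).mapL T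
  have h2 : ∀ g, T (lp.single 2 g (ξ g)) = 0 := fun g => by
    have : lp.single 2 g (ξ g) = ξ g • (pointMass g) := by
      refine Subtype.ext (funext fun x => ?_)
      change lp.single (E := fun _ : Γ => ℂ) 2 g (ξ g) x = ξ g * (pointMass g) x
      rw [pointMass_apply, lp.single_apply]
      by_cases hh : x = g
      · subst hh; simp
      · simp [hh]
    rw [this, map_smul, h, smul_zero]
  simp only [h2] at h1
  rw [zero_apply]
  exact h1.unique hasSum_zero

/-- An element of `A ⊗ C*_r(Γ)` is zero if all its matrix coefficients at point masses vanish. -/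
theorem eq_zero_of_inner_pointMass (z : MinTensor A (RedGroupAlg Γ))
    (h : ∀ (π : CStarRep A) (ξ ξ' : π.H) (s t : Γ),
      (inner ℂ (CStarRep.tensR (π, regRep Γ) (pointMass t) ξ')
        (MinTensor.rep (π, regRep Γ) z (CStarRep.tensR (π, regRep Γ) (pointMass s) ξ)) : ℂ) = 0) :
    z = 0 := by
  refine MinTensor.ext_rep fun P => ?_
  rw [map_zero]
  refine CStarRep.clm_eq_zero P fun ξ ξ' η η' => ?_
  -- An operator on `ℓ²(Γ)` is determined by its coefficients at point masses. Elements of the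
  -- reduced algebra are such operators, so the slice vanishes in the algebra and hence under `P.2`.
  have h0 : sliceL (P.1, regRep Γ) ξ ξ' z = 0 := by
    refine clm_ext_pointMass fun s => Subtype.ext (funext fun t => ?_)
    have := (inner_sliceL (P.1, regRep Γ) (pointMass s) (pointMass t) ξ ξ' z).trans
      (h P.1 ξ ξ' s t)
    exact (inner_pointMass t _).symm.trans this
  have h1 : regSlice P.1 ξ ξ' z = 0 := Subtype.ext h0
  rw [inner_rep_eq_regSlice, h1, map_zero, zero_apply, inner_zero_right]

theorem RedGroupAlg.of_mul (g h : Γ) : of g * of h = of (g * h) := by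
  refine Subtype.ext (ContinuousLinearMap.ext fun ξ => Subtype.ext (funext fun x => ?_))
  change ξ (h⁻¹ * (g⁻¹ * x)) = ξ ((g * h)⁻¹ * x)
  rw [mul_inv_rev, mul_assoc]

theorem RedGroupAlg.star_of (g : Γ) : star (of g) = of g⁻¹ := by
  refine Subtype.ext ?_
  change ContinuousLinearMap.adjoint (leftRegular g) = leftRegular g⁻¹
  symm
  rw [ContinuousLinearMap.eq_adjoint_iff]
  intro x y
  rw [lp.inner_eq_tsum, lp.inner_eq_tsum]
  rw [← (Equiv.mulLeft g⁻¹).tsum_eq]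
  refine tsum_congr fun h => ?_
  change inner ℂ (x (g⁻¹⁻¹ * (g⁻¹ * h))) (y (g⁻¹ * h)) = inner ℂ (x h) (y (g⁻¹ * h))
  simp

theorem RedGroupAlg.of_one_mul (c : RedGroupAlg Γ) : of 1 * c = c := by
  refine Subtype.ext (ContinuousLinearMap.ext fun ξ => Subtype.ext (funext fun x => ?_))
  change (c.1 ξ) (1⁻¹ * x) = _
  simp

theorem RedGroupAlg.mul_of_one (c : RedGroupAlg Γ) : c * of 1 = c := by
  refine Subtype.ext (ContinuousLinearMap.ext fun ξ => ?_)
  change c.1 (leftRegular 1 ξ) = c.1 ξ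
  congr 1
  refine Subtype.ext (funext fun x => ?_)
  change ξ (1⁻¹ * x) = ξ x
  simp

end RegularSlice

/-! ### The Schur test and sparse matrices. -/

section Schur
variable {V : ℕ → Type v} [∀ k, Fintype (V k)] [∀ k, DecidableEq (V k)]

/-- The Schur test. -/
theorem norm_ofMatrix_le (k : ℕ) (T : Matrix (V k) (V k) ℂ) {c : ℝ} (hc : 0 ≤ c)
    (hrow : ∀ x, ∑ y, ‖T x y‖ ≤ c) (hcol : ∀ y, ∑ x, ‖T x y‖ ≤ c) :
    ‖(CStarMatrix.ofMatrix T : MatAlg V k)‖ ≤ c := by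
  rw [← norm_matHom]
  refine ContinuousLinearMap.opNorm_le_bound _ hc fun ξ => ?_
  refine abs_le_of_sq_le_sq' ?_ (by positivity) |>.2
  have happ : ∀ x, (matHom V k (CStarMatrix.ofMatrix T) ξ) x = ∑ y, T x y * ξ y := fun x => rfl
  rw [EuclideanSpace.norm_sq_eq, mul_pow, EuclideanSpace.norm_sq_eq]
  calc ∑ x, ‖(matHom V k (CStarMatrix.ofMatrix T) ξ) x‖ ^ 2
      ≤ ∑ x, (∑ y, ‖T x y‖ * ‖ξ y‖) ^ 2 := by
        refine Finset.sum_le_sum fun x _ => ?_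
        rw [happ]
        gcongr
        exact (norm_sum_le _ _).trans_eq (by simp only [norm_mul])
    _ ≤ ∑ x, c * ∑ y, ‖T x y‖ * ‖ξ y‖ ^ 2 := by
        refine Finset.sum_le_sum fun x _ => ?_
        -- Cauchy–Schwarz, with `|T x y| |ξ y|` split as `√|T x y|` times `√|T x y| |ξ y|`.
        refine (Finset.sum_sq_le_sum_mul_sum_of_sq_le_mul _ (f := fun y => ‖T x y‖)
          (g := fun y => ‖T x y‖ * ‖ξ y‖ ^ 2) (fun _ _ => by positivity) (fun _ _ => by positivity)
          (fun _ _ => le_of_eq (by ring))).trans ?_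
        gcongr
        exact hrow x
    _ = c * ∑ y, (∑ x, ‖T x y‖) * ‖ξ y‖ ^ 2 := by
        rw [← Finset.mul_sum, Finset.sum_comm]
        simp only [Finset.sum_mul]
    _ ≤ c * ∑ y, c * ‖ξ y‖ ^ 2 := by
        gcongr with y _
        exact hcol y
    _ = c ^ 2 * ∑ y, ‖ξ y‖ ^ 2 := by rw [← Finset.mul_sum]; ring

/-- The norm of a matrix with few nonzero entries in each row and column. -/
theorem norm_ofMatrix_le_of_card (k : ℕ) (T : Matrix (V k) (V k) ℂ) {c : ℝ} {N : ℕ} (hc : 0 ≤ c)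
    (hT : ∀ x y, ‖T x y‖ ≤ c) (r s : V k → Finset (V k)) (hr : ∀ x, (r x).card ≤ N)
    (hs : ∀ y, (s y).card ≤ N) (hTr : ∀ x y, T x y ≠ 0 → y ∈ r x) (hTs : ∀ x y, T x y ≠ 0 → x ∈ s y) :
    ‖(CStarMatrix.ofMatrix T : MatAlg V k)‖ ≤ N * c := by
  refine norm_ofMatrix_le k T (by positivity) (fun x => ?_) (fun y => ?_)
  · calc ∑ y, ‖T x y‖ = ∑ y ∈ r x, ‖T x y‖ := by
          refine (Finset.sum_subset (Finset.subset_univ _) fun y _ hy => ?_).symm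
          rw [norm_eq_zero]
          exact not_not.1 fun h => hy (hTr x y h)
      _ ≤ (r x).card • c := Finset.sum_le_card_nsmul _ _ _ fun y _ => hT x y
      _ ≤ N * c := by rw [nsmul_eq_mul]; gcongr; exact hr x
  · calc ∑ x, ‖T x y‖ = ∑ x ∈ s y, ‖T x y‖ := by
          refine (Finset.sum_subset (Finset.subset_univ _) fun x _ hx => ?_).symm
          rw [norm_eq_zero]
          exact not_not.1 fun h => hx (hTs x y h)
      _ ≤ (s y).card • c := Finset.sum_le_card_nsmul _ _ _ fun x _ => hT x y
      _ ≤ N * c := by rw [nsmul_eq_mul]; gcongr; exact hs y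

end Schur

/-! ### Balls in Cayley graphs and regular graphs; spectra of Laplacians. -/

section Graphs

theorem SimpleGraph.mulCayley_connected {Γ : Type u} [Group Γ] {S : Set Γ}
    (hS : Subgroup.closure S = ⊤) : (mulCayley S).Connected := by
  have key : ∀ g : Γ, ∀ a, (mulCayley S).Reachable a (a * g) := by
    intro g
    have hg : g ∈ Subgroup.closure S := hS ▸ Subgroup.mem_top g
    induction hg using Subgroup.closure_induction with
    | mem s hs =>
      intro a
      by_cases h : a = a * s
      · rw [← h]
      · exact Adj.reachable ((mulCayley_adj _ _ _).2 ⟨h, Or.inl (by simpa using hs)⟩)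
    | one => intro a; rw [mul_one]
    | mul g h _ _ hg hh => intro a; rw [← mul_assoc]; exact (hg a).trans (hh _)
    | inv g _ hg => intro a; simpa using (hg (a * g⁻¹)).symm
  exact ⟨fun a b => by simpa using key (a⁻¹ * b) a⟩

/-- An edge multiplies on the right by an element of `S ∪ S⁻¹`, so the displacements along walks of
length `n` lie in an `n`-fold product of finite sets, whatever the starting point. -/
theorem SimpleGraph.finite_mulCayley_walks {Γ : Type u} [Group Γ] {S : Set Γ} (hS : S.Finite) (n : ℕ) :
    ∃ F : Set Γ, F.Finite ∧ ∀ (a b : Γ) (p : (mulCayley S).Walk a b), p.length = n → a⁻¹ * b ∈ F := by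
  induction n with
  | zero =>
    refine ⟨{1}, Set.finite_singleton _, fun a b p hp => ?_⟩
    rw [Walk.eq_of_length_eq_zero hp]
    simp
  | succ n ih =>
    obtain ⟨F, hF, h⟩ := ih
    refine ⟨Set.image2 (· * ·) (S ∪ S⁻¹) F, (hS.union hS.inv).image2 _ hF, fun a b p hp => ?_⟩
    cases p with
    | nil => simp at hp
    | @cons _ c _ hadj q =>
      refine ⟨a⁻¹ * c, ?_, c⁻¹ * b, h c b q (by simpa using hp), by group⟩
      rcases ((mulCayley_adj _ _ _).1 hadj).2 with h1 | h1
      · exact Or.inl h1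
      · exact Or.inr (by simpa using h1)

/-- Balls in Cayley graphs of finitely generated groups are finite. -/
theorem SimpleGraph.finite_mulCayley_ball {Γ : Type u} [Group Γ] {S : Set Γ} (hfin : S.Finite)
    (hS : Subgroup.closure S = ⊤) (R : ℕ) :
    ∃ F : Finset Γ, ∀ a b : Γ, (mulCayley S).dist a b ≤ R → a⁻¹ * b ∈ F := by
  choose F hF h using finite_mulCayley_walks (Γ := Γ) hfin
  refine ⟨((Set.finite_Iic R).biUnion fun n _ => hF n).toFinset, fun a b hab => ?_⟩
  obtain ⟨p, hp⟩ := (mulCayley_connected hS).exists_walk_length_eq_dist a b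
  simp only [Set.Finite.mem_toFinset, Set.mem_iUnion]
  exact ⟨p.length, hp ▸ hab, h _ a b p rfl⟩

variable {V : Type v} [Fintype V] (G : SimpleGraph V) [DecidableRel G.Adj]

open scoped Classical in
theorem SimpleGraph.IsRegularOfDegree.card_walks_le {d : ℕ} (hd : G.IsRegularOfDegree d) (n : ℕ)
    (x : V) : (Finset.univ.filter fun y => ∃ p : G.Walk x y, p.length = n).card ≤ d ^ n := by
  induction n generalizing x with
  | zero =>
    rw [pow_zero]
    refine Finset.card_le_one.2 fun y hy z hz => ?_
    simp only [Finset.mem_filter, Finset.mem_univ, true_and] at hy hz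
    obtain ⟨p, hp⟩ := hy
    obtain ⟨q, hq⟩ := hz
    rw [← Walk.eq_of_length_eq_zero hp, ← Walk.eq_of_length_eq_zero hq]
  | succ n ih =>
    have hsub : (Finset.univ.filter fun y => ∃ p : G.Walk x y, p.length = n + 1) ⊆
        (G.neighborFinset x).biUnion fun z =>
          Finset.univ.filter fun y => ∃ p : G.Walk z y, p.length = n := by
      intro y hy
      simp only [Finset.mem_filter, Finset.mem_univ, true_and] at hy
      obtain ⟨p, hp⟩ := hy
      cases p with
      | nil => simp at hp
      | @cons _ c _ hadj q =>
        simp only [Finset.mem_biUnion, mem_neighborFinset, Finset.mem_filter, Finset.mem_univ, true_and]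
        exact ⟨c, hadj, q, by simpa using hp⟩
    refine (Finset.card_le_card hsub).trans ?_
    refine (Finset.card_biUnion_le_card_mul _ _ _ fun z _ => ih z).trans ?_
    rw [card_neighborFinset_eq_degree, hd x, pow_succ, mul_comm]

-- A vertex at distance `n` is the end of a walk of length `n`, and there are at most `d ^ n` such
-- ends. The bound does not depend on the size of the graph, which makes it uniform over the family.
open scoped Classical in
theorem SimpleGraph.IsRegularOfDegree.card_ball_le {d : ℕ} (hd : G.IsRegularOfDegree d)
    (hG : G.Connected) (R : ℕ) (x : V) :
    (Finset.univ.filter fun y => G.dist x y < R).card ≤ ∑ n ∈ Finset.range R, d ^ n := by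
  have hsub : (Finset.univ.filter fun y => G.dist x y < R) ⊆ (Finset.range R).biUnion fun n =>
      Finset.univ.filter fun y => ∃ p : G.Walk x y, p.length = n := by
    intro y hy
    simp only [Finset.mem_filter, Finset.mem_univ, true_and] at hy
    simp only [Finset.mem_biUnion, Finset.mem_filter, Finset.mem_univ, true_and, Finset.mem_range]
    exact ⟨_, hy, hG.exists_walk_length_eq_dist x y⟩
  refine (Finset.card_le_card hsub).trans (Finset.card_biUnion_le.trans ?_)
  exact Finset.sum_le_sum fun n _ => hd.card_walks_le G n x

variable [DecidableEq V]

theorem SimpleGraph.lapMatrix_map_ofReal :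
    (G.lapMatrix ℝ).map Complex.ofReal = G.lapMatrix ℂ := by
  ext i j
  simp only [lapMatrix, degMatrix, Matrix.map_apply, Matrix.sub_apply, Matrix.diagonal_apply,
    adjMatrix_apply]
  split_ifs <;> simp

/-- Over a connected graph, the complex harmonic functions are constant. -/
theorem SimpleGraph.Connected.eq_of_lapMatrix_mulVec_eq_zero (hG : G.Connected) {φ : V → ℂ}
    (h : (G.lapMatrix ℂ).mulVec φ = 0) (x y : V) : φ x = φ y := by
  -- The Laplacian has real entries, so real and imaginary parts are separately harmonic and the
  -- real theorem applies to each.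
  have hre : (G.lapMatrix ℝ).mulVec (fun x => (φ x).re) = 0 := by
    ext x
    have := congrArg Complex.re (congrFun h x)
    rw [lapMatrix_mulVec_apply] at this ⊢
    simpa using this
  have him : (G.lapMatrix ℝ).mulVec (fun x => (φ x).im) = 0 := by
    ext x
    have := congrArg Complex.im (congrFun h x)
    rw [lapMatrix_mulVec_apply] at this ⊢
    simpa using this
  rw [lapMatrix_mulVec_eq_zero_iff_forall_reachable] at hre him
  exact Complex.ext (hre x y (hG.preconnected x y)) (him x y (hG.preconnected x y))

/-- The gap is assumed for the real matrix, while the C*-algebra contains the complex one. For real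
`t` the matrix `t - L` is real, and the vanishing of its determinant does not depend on the field.
-/
theorem SimpleGraph.hasEigenvalue_lapMatrix_of_mem_spectrum {t : ℝ}
    (ht : ¬ IsUnit (algebraMap ℝ (Matrix V V ℂ) t - G.lapMatrix ℂ)) :
    Module.End.HasEigenvalue (Matrix.toLin' (G.lapMatrix ℝ)) t := by
  have h1 : algebraMap ℝ (Matrix V V ℂ) t - G.lapMatrix ℂ =
      (Matrix.scalar V t - G.lapMatrix ℝ).map Complex.ofRealHom := by
    rw [← lapMatrix_map_ofReal]
    ext i j
    simp only [Matrix.algebraMap_eq_diagonal, Matrix.sub_apply, Matrix.map_apply, Matrix.scalar_apply,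
      Matrix.diagonal_apply]
    split_ifs <;> simp
  rw [h1, Matrix.isUnit_iff_isUnit_det, isUnit_iff_ne_zero, not_not] at ht
  have h2 : (Matrix.scalar V t - G.lapMatrix ℝ).det = 0 := by
    have := RingHom.map_det Complex.ofRealHom (Matrix.scalar V t - G.lapMatrix ℝ)
    rw [RingHom.mapMatrix_apply, ht] at this
    simpa using this
  obtain ⟨φ, hφ0, hφ⟩ := Matrix.exists_mulVec_eq_zero_iff.2 h2
  refine Module.End.hasEigenvalue_of_hasEigenvector (x := φ) ⟨?_, hφ0⟩
  rw [Module.End.mem_eigenspace_iff, Matrix.toLin'_apply]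
  rw [Matrix.sub_mulVec, sub_eq_zero] at hφ
  rw [← hφ]
  ext i
  simp [Matrix.mulVec_diagonal]

end Graphs

/-! ### Functional calculus for an operator with isolated spectral value zero. -/

section SpectralGap
variable {A : Type v} [NonUnitalCStarAlgebra A]

/-- This function replaces `1/t`: it equals `1/t` on `[ε, ∞)`, vanishes at `0` and is continuous
everywhere. Multiplied by `t` it agrees with the discontinuous indicator on a spectrum with gap `ε`.
-/
theorem continuous_gapFun {ε : ℝ} (hε : 0 < ε) : Continuous fun t : ℝ => t / max t ε ^ 2 :=
  continuous_id.div (by fun_prop) fun t => by positivity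

theorem indicator_eqOn_gapFun {ε : ℝ} (hε : 0 < ε) {L : A}
    (hL : ∀ t ∈ quasispectrum ℝ L, t = 0 ∨ ε ≤ t) :
    (quasispectrum ℝ L).EqOn (fun t : ℝ => if t = 0 then 0 else 1)
      (fun t => t / max t ε ^ 2 * t) := by
  intro t ht
  rcases hL t ht with rfl | h
  · simp
  · have h0 : t ≠ 0 := (hε.trans_le h).ne'
    simp only [h0, if_false, max_eq_left h]
    field_simp

/-- If `0` is isolated in the spectrum, then the complement of the support projection is determined
by being the largest projection annihilated by the operator. -/
theorem sub_cfcₙ_indicator_eq {ε : ℝ} (hε : 0 < ε) {L p u : A} (hsa : IsSelfAdjoint L)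
    (hL : ∀ t ∈ quasispectrum ℝ L, t = 0 ∨ ε ≤ t) (hu : ∀ z, u * z = z ∧ z * u = z)
    (hp : IsSelfAdjoint p) (hLp : L * p = 0) (hker : ∀ r, L * r = 0 → p * r = r) :
    u - cfcₙ (fun t : ℝ => if t = 0 then 0 else 1) L = p := by
  have hg := continuous_gapFun hε
  have hgc : ContinuousOn (fun t : ℝ => t / max t ε ^ 2) (quasispectrum ℝ L) := hg.continuousOn
  set e := cfcₙ (fun t : ℝ => if t = 0 then 0 else 1) L with he
  have he1 : e = cfcₙ (fun t : ℝ => t / max t ε ^ 2) L * L := by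
    rw [he, cfcₙ_congr (indicator_eqOn_gapFun hε hL),
      cfcₙ_mul (fun t : ℝ => t / max t ε ^ 2) (fun t => t) L hgc (by simp) (by fun_prop) rfl,
      cfcₙ_id' ℝ L hsa]
  have hesa : IsSelfAdjoint e := cfcₙ_predicate _ _
  have hus : IsSelfAdjoint u := by
    have h1 := (hu (star u)).1
    have h2 := congrArg star h1
    rw [star_mul, star_star] at h2
    exact h1.symm.trans h2
  -- On the spectrum `t` times the indicator of `t ≠ 0` is `t`. The rewriting expresses the
  -- indicator through the gap function, where continuity is available.
  have hLe : L * e = L := by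
    rw [he1]
    nth_rw 1 [← cfcₙ_id' ℝ L hsa]
    nth_rw 3 [← cfcₙ_id' ℝ L hsa]
    rw [← cfcₙ_mul (fun t : ℝ => t / max t ε ^ 2) (fun t => t) L hgc (by simp) (by fun_prop) rfl,
      ← cfcₙ_mul (fun t : ℝ => t) (fun t => t / max t ε ^ 2 * t) L (by fun_prop) rfl
        (hgc.mul continuousOn_id) (by simp)]
    nth_rw 2 [← cfcₙ_id' ℝ L hsa]
    refine cfcₙ_congr fun t ht => ?_
    have := indicator_eqOn_gapFun hε hL ht
    dsimp only at this ⊢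
    rw [← this]
    by_cases h : t = 0 <;> simp [h]
  have hr : IsSelfAdjoint (u - e) := hus.sub hesa
  -- Each of `p` and `u - e` absorbs the other: `L(u - e) = 0` gives `p(u - e) = u - e`, and `ep =
  -- 0` gives `(u - e)p = p`. Taking the adjoint of the second identity shows that they coincide.
  have h1 : p * (u - e) = u - e := hker _ (by rw [mul_sub, hLe, (hu L).2, sub_self])
  have h2 : (u - e) * p = p := by rw [sub_mul, (hu p).1, he1, mul_assoc, hLp, mul_zero, sub_zero]
  have h3 := congrArg star h2
  rw [star_mul, hp.star_eq, hr.star_eq] at h3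
  exact h1.symm.trans h3

theorem continuousOn_indicator {ε : ℝ} (hε : 0 < ε) {L : A}
    (hL : ∀ t ∈ quasispectrum ℝ L, t = 0 ∨ ε ≤ t) :
    ContinuousOn (fun t : ℝ => if t = 0 then (0 : ℝ) else 1) (quasispectrum ℝ L) :=
  ContinuousOn.congr ((continuous_gapFun hε).mul continuous_id).continuousOn
    (indicator_eqOn_gapFun hε hL)

theorem map_cfcₙ_indicator {B : Type w} [NonUnitalCStarAlgebra B] (φ : A →⋆ₙₐ[ℂ] B) {ε : ℝ}
    (hε : 0 < ε) {L : A} (hsa : IsSelfAdjoint L) (hL : ∀ t ∈ quasispectrum ℝ L, t = 0 ∨ ε ≤ t) :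
    φ (cfcₙ (fun t : ℝ => if t = 0 then 0 else 1) L) =
      cfcₙ (fun t : ℝ => if t = 0 then 0 else 1) (φ L) :=
  NonUnitalStarAlgHom.map_cfcₙ φ _ L (continuousOn_indicator hε hL) (by simp)
    (continuous_starHom φ) hsa (hsa.map φ)

/-- The kernel condition on `p` can be checked among matrices, but not directly in the tensor
product; the identity is therefore proved in the source and pushed forward. It is applied with `φ =
ι_k`. -/
theorem map_sub_cfcₙ_indicator_eq {B : Type w} [NonUnitalCStarAlgebra B] (φ : A →⋆ₙₐ[ℂ] B) {ε : ℝ}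
    (hε : 0 < ε) {L p u : A} (hsa : IsSelfAdjoint L)
    (hL : ∀ t ∈ quasispectrum ℝ L, t = 0 ∨ ε ≤ t) (hu : ∀ z, u * z = z ∧ z * u = z)
    (hp : IsSelfAdjoint p) (hLp : L * p = 0) (hker : ∀ r, L * r = 0 → p * r = r) :
    φ u - cfcₙ (fun t : ℝ => if t = 0 then 0 else 1) (φ L) = φ p := by
  rw [← map_cfcₙ_indicator φ hε hsa hL, ← map_sub, sub_cfcₙ_indicator_eq hε hsa hL hu hp hLp hker]

end SpectralGap

/-! ### The homomorphisms `ι_k` and elements of finite propagation. -/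

section Iota
variable {Γ : Type u} [Group Γ] {V : ℕ → Type v} [∀ k, Fintype (V k)] [∀ k, DecidableEq (V k)]
  (f : ∀ k, V k → Γ)

theorem CStarMatrix.ofMatrix_sum {n : Type*} {ι : Type*} (s : Finset ι) (T : ι → Matrix n n ℂ) :
    CStarMatrix.ofMatrix (∑ i ∈ s, T i) = ∑ i ∈ s, CStarMatrix.ofMatrix (T i) :=
  map_sum (CStarMatrix.ofMatrixₗ (R := ℂ) (m := n) (n := n) (A := ℂ)) T s

theorem iotaMap_add (k : ℕ) (T T' : Matrix (V k) (V k) ℂ) :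
    iotaMap f k (T + T') = iotaMap f k T + iotaMap f k T' := by
  simp only [iotaMap, ← Finset.sum_add_distrib, ← MinTensor.tmul_add_left, CStarMatrix.of_add_of,
    Matrix.add_apply, Matrix.single_add]

theorem iotaMap_smul (k : ℕ) (c : ℂ) (T : Matrix (V k) (V k) ℂ) :
    iotaMap f k (c • T) = c • iotaMap f k T := by
  simp only [iotaMap, Finset.smul_sum, ← MinTensor.tmul_smul_left, CStarMatrix.smul_of,
    Matrix.smul_apply, Matrix.smul_single]

theorem iotaMap_star (k : ℕ) (T : Matrix (V k) (V k) ℂ) :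
    iotaMap f k T.conjTranspose = star (iotaMap f k T) := by
  simp only [iotaMap, star_sum, MinTensor.star_tmul, RedGroupAlg.star_of]
  rw [Finset.sum_comm]
  refine Finset.sum_congr rfl fun x _ => Finset.sum_congr rfl fun y _ => ?_
  have h1 : (CStarMatrix.ofMatrix (Matrix.single y x (T.conjTranspose y x)) : MatAlg V k) =
      star (CStarMatrix.ofMatrix (Matrix.single x y (T x y))) := by
    change _ = CStarMatrix.ofMatrix (Matrix.conjTranspose (Matrix.single x y (T x y)))
    rw [Matrix.conjTranspose_single, Matrix.conjTranspose_apply]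
  rw [h1]
  congr 2
  group

/-- The labels form a cocycle, `f(x)⁻¹f(y) · f(y)⁻¹f(z) = f(x)⁻¹f(z)`, so matrix units multiply
correctly; no property of `f` is involved. -/
theorem iotaMap_mul (k : ℕ) (T T' : Matrix (V k) (V k) ℂ) :
    iotaMap f k (T * T') = iotaMap f k T * iotaMap f k T' := by
  have h1 : ∀ x y x' y', MinTensor.tmul (CStarMatrix.ofMatrix (Matrix.single x y (T x y)) : MatAlg V k)
      (RedGroupAlg.of ((f k x)⁻¹ * f k y)) *
      MinTensor.tmul (CStarMatrix.ofMatrix (Matrix.single x' y' (T' x' y')))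
      (RedGroupAlg.of ((f k x')⁻¹ * f k y')) = if y = x' then
        MinTensor.tmul (CStarMatrix.ofMatrix (Matrix.single x y' (T x y * T' y y')))
        (RedGroupAlg.of ((f k x)⁻¹ * f k y')) else 0 := by
    intro x y x' y'
    rw [MinTensor.tmul_mul, RedGroupAlg.of_mul]
    have h2 : (CStarMatrix.ofMatrix (Matrix.single x y (T x y)) *
      CStarMatrix.ofMatrix (Matrix.single x' y' (T' x' y')) : MatAlg V k) =
      CStarMatrix.ofMatrix (Matrix.single x y (T x y) * Matrix.single x' y' (T' x' y')) := rfl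
    rw [h2]
    split_ifs with h
    · subst h
      rw [Matrix.single_mul_single_same]
      congr 2
      group
    · rw [Matrix.single_mul_single_of_ne (h := h)]
      exact MinTensor.tmul_zero_left _
  have h2 : ∀ x y', MinTensor.tmul (CStarMatrix.ofMatrix (Matrix.single x y' ((T * T') x y')) : MatAlg V k)
      (RedGroupAlg.of ((f k x)⁻¹ * f k y')) = ∑ y,
        MinTensor.tmul (CStarMatrix.ofMatrix (Matrix.single x y' (T x y * T' y y')))
        (RedGroupAlg.of ((f k x)⁻¹ * f k y')) := by
    intro x y'
    rw [← MinTensor.tmul_sum_left, ← CStarMatrix.ofMatrix_sum, Matrix.mul_apply]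
    congr 2
    exact map_sum (Matrix.singleAddMonoidHom x y') _ _
  simp only [iotaMap, Finset.sum_mul_sum, h1, h2]
  refine Finset.sum_congr rfl fun x _ => ?_
  rw [Finset.sum_comm]
  refine Eq.trans (Finset.sum_congr rfl fun y _ => ?_) Finset.sum_comm
  rw [Finset.sum_comm]
  exact Finset.sum_congr rfl fun y' _ => by simp

/-- The map `ιₖ` as a *-homomorphism. -/
def iotaHom (k : ℕ) : MatAlg V k →⋆ₙₐ[ℂ] MinTensor (MatAlg V k) (RedGroupAlg Γ) where
  toFun a := iotaMap f k (CStarMatrix.ofMatrix.symm a)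
  map_smul' c a := iotaMap_smul f k c (CStarMatrix.ofMatrix.symm a)
  map_zero' := by
    have h := iotaMap_smul f k 0 0
    rw [zero_smul, zero_smul] at h
    exact h
  map_add' a b := iotaMap_add f k (CStarMatrix.ofMatrix.symm a) (CStarMatrix.ofMatrix.symm b)
  map_mul' a b := iotaMap_mul f k (CStarMatrix.ofMatrix.symm a) (CStarMatrix.ofMatrix.symm b)
  map_star' a := iotaMap_star f k (CStarMatrix.ofMatrix.symm a)

theorem HasComponents.unique {T : ∀ k, Matrix (V k) (V k) ℂ}
    {z w : MinTensor (ProdAlg (MatAlg V)) (RedGroupAlg Γ)}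
    (hz : HasComponents f T z) (hw : HasComponents f T w) : z = w :=
  eq_of_map_coordHom fun k => (hz k).trans (hw k).symm

theorem HasComponents.eq_iff {T : ∀ k, Matrix (V k) (V k) ℂ}
    {w : MinTensor (ProdAlg (MatAlg V)) (RedGroupAlg Γ)} (hw : HasComponents f T w) (z) :
    HasComponents f T z ↔ z = w :=
  ⟨fun hz => hz.unique f hw, fun h => h ▸ hw⟩

open scoped Classical in
/-- The family of matrices obtained by keeping only the entries `(x, y)` with `f(x)⁻¹f(y) = g`. -/
def diagonalPart (T : ∀ k, Matrix (V k) (V k) ℂ) (g : Γ) (k : ℕ) : Matrix (V k) (V k) ℂ :=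
  Matrix.of fun x y => if (f k x)⁻¹ * f k y = g then T k x y else 0

/-- Regrouping the entries by group label turns a sum indexed by pairs of vertices into one indexed
by `F`. When `F` serves all `k`, the same finite sum makes sense over the product. -/
theorem iotaMap_eq_sum_diagonalPart (T : ∀ k, Matrix (V k) (V k) ℂ) (F : Finset Γ) (k : ℕ)
    (hF : ∀ x y, T k x y ≠ 0 → (f k x)⁻¹ * f k y ∈ F) :
    iotaMap f k (T k) = ∑ g ∈ F, MinTensor.tmul
      (CStarMatrix.ofMatrix (diagonalPart f T g k) : MatAlg V k) (RedGroupAlg.of g) := by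
  classical
  have h1 : ∀ g, MinTensor.tmul
      (CStarMatrix.ofMatrix (diagonalPart f T g k) : MatAlg V k) (RedGroupAlg.of g) =
      ∑ x, ∑ y, if (f k x)⁻¹ * f k y = g then
        MinTensor.tmul (CStarMatrix.ofMatrix (Matrix.single x y (T k x y)) : MatAlg V k)
          (RedGroupAlg.of g) else 0 := by
    intro g
    conv_lhs => rw [Matrix.matrix_eq_sum_single (diagonalPart f T g k)]
    simp only [CStarMatrix.ofMatrix_sum, MinTensor.tmul_sum_left]
    refine Finset.sum_congr rfl fun x _ => Finset.sum_congr rfl fun y _ => ?_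
    simp only [diagonalPart, Matrix.of_apply]
    split_ifs with h
    · rfl
    · rw [Matrix.single_zero]
      exact MinTensor.tmul_zero_left _
  simp only [h1, iotaMap]
  refine Eq.trans (Finset.sum_congr rfl fun x _ => ?_) Finset.sum_comm
  refine Eq.trans ?_ Finset.sum_comm
  refine Finset.sum_congr rfl fun y _ => ?_
  rw [Finset.sum_ite_eq]
  split_ifs with h
  · rfl
  · have h0 : T k x y = 0 := not_not.1 fun h0 => h (hF x y h0)
    rw [h0, Matrix.single_zero]
    exact MinTensor.tmul_zero_left _

/-- A family of matrices of uniformly bounded entries and propagation defines an element of the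
minimal tensor product. -/
theorem exists_hasComponents (T : ∀ k, Matrix (V k) (V k) ℂ) (F : Finset Γ)
    (hF : ∀ k x y, T k x y ≠ 0 → (f k x)⁻¹ * f k y ∈ F) {c : ℝ} {N : ℕ} (hc : 0 ≤ c)
    (hT : ∀ k x y, ‖T k x y‖ ≤ c) (r : ∀ k, V k → Finset (V k)) (hr : ∀ k x, (r k x).card ≤ N)
    (hTr : ∀ k x y, T k x y ≠ 0 → y ∈ r k x ∧ x ∈ r k y) :
    ∃ z : MinTensor (ProdAlg (MatAlg V)) (RedGroupAlg Γ), HasComponents f T z := by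
  have hne : ∀ g k x y, diagonalPart f T g k x y ≠ 0 → T k x y ≠ 0 := by
    intro g k x y h h0
    simp [diagonalPart, h0] at h
  have hb : ∀ g k, ‖(CStarMatrix.ofMatrix (diagonalPart f T g k) : MatAlg V k)‖ ≤ N * c := by
    intro g k
    refine norm_ofMatrix_le_of_card k _ hc (fun x y => ?_) (r k) (r k) (hr k) (hr k)
      (fun x y h => (hTr k x y (hne g k x y h)).1) (fun x y h => (hTr k x y (hne g k x y h)).2)
    simp only [diagonalPart, Matrix.of_apply]
    split_ifs
    · exact hT k x y
    · simpa using hc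
  -- The coefficient of `g`: the sparse-matrix bound `N * c` is uniform in `k`, so this family lies
  -- in the product.
  let a : Γ → ProdAlg (MatAlg V) := fun g =>
    ⟨fun k => CStarMatrix.ofMatrix (diagonalPart f T g k), memℓp_infty ⟨N * c, by
      rintro _ ⟨k, rfl⟩
      exact hb g k⟩⟩
  refine ⟨∑ g ∈ F, MinTensor.tmul (a g) (RedGroupAlg.of g), fun k => ?_⟩
  rw [map_sum, iotaMap_eq_sum_diagonalPart f T F k (hF k)]
  rfl

/-- The identity of the product of matrix algebras. -/
def oneFam (V : ℕ → Type v) [∀ k, Fintype (V k)] [∀ k, DecidableEq (V k)] : ProdAlg (MatAlg V) :=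
  ⟨fun k => CStarMatrix.ofMatrix (1 : Matrix (V k) (V k) ℂ), memℓp_infty ⟨1, by
    rintro _ ⟨k, rfl⟩
    refine norm_ofMatrix_le k _ zero_le_one (fun x => ?_) (fun x => ?_) <;>
      simp [Matrix.one_apply, apply_ite]⟩⟩

theorem oneFam_mul (a : ProdAlg (MatAlg V)) : oneFam V * a = a :=
  Subtype.ext (funext fun k => Matrix.one_mul (CStarMatrix.ofMatrix.symm (a k)))

theorem mul_oneFam (a : ProdAlg (MatAlg V)) : a * oneFam V = a :=
  Subtype.ext (funext fun k => Matrix.mul_one (CStarMatrix.ofMatrix.symm (a k)))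

/-- The identity of the tensor product. -/
def tensorOne (V : ℕ → Type v) [∀ k, Fintype (V k)] [∀ k, DecidableEq (V k)] (Γ : Type u) [Group Γ] :
    MinTensor (ProdAlg (MatAlg V)) (RedGroupAlg Γ) :=
  MinTensor.tmul (oneFam V) (RedGroupAlg.of 1)

theorem tensorOne_mul (z : MinTensor (ProdAlg (MatAlg V)) (RedGroupAlg Γ)) :
    tensorOne V Γ * z = z ∧ z * tensorOne V Γ = z := by
  induction z using MinTensor.induction_on with
  | closed =>
    exact (isClosed_eq (by fun_prop) (by fun_prop)).inter (isClosed_eq (by fun_prop) (by fun_prop))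
  | tmul a c =>
    rw [tensorOne, MinTensor.tmul_mul, MinTensor.tmul_mul, oneFam_mul, mul_oneFam,
      RedGroupAlg.of_one_mul, RedGroupAlg.mul_of_one]
    exact ⟨rfl, rfl⟩
  | add x y hx hy => rw [mul_add, add_mul, hx.1, hx.2, hy.1, hy.2]; exact ⟨rfl, rfl⟩

theorem tensorOne_hasComponents : HasComponents f (fun _ => 1) (tensorOne V Γ) := by
  intro k
  rw [iotaMap_eq_sum_diagonalPart f (fun _ => 1) {1} k]
  · rw [Finset.sum_singleton]
    have : diagonalPart f (fun k => (1 : Matrix (V k) (V k) ℂ)) 1 k = 1 := by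
      ext x y
      simp only [diagonalPart, Matrix.of_apply, Matrix.one_apply]
      by_cases h : x = y
      · simp [h]
      · simp [h]
    rw [this]
    rfl
  · intro x y h
    have : x = y := not_not.1 fun hxy => h (Matrix.one_apply_ne hxy)
    simp [this]

end Iota

/-! ### The element `Δ`, its spectral gap and its kernel projection. -/

section Laplacian
variable {Γ : Type u} [Group Γ] {V : ℕ → Type v} [∀ k, Fintype (V k)] [∀ k, DecidableEq (V k)]
  (f : ∀ k, V k → Γ)

theorem quasispectrum_lapMatrix {k : ℕ} {G : SimpleGraph (V k)} [DecidableRel G.Adj] {ε : ℝ}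
    (h : ∀ μ : ℝ, Module.End.HasEigenvalue (Matrix.toLin' (G.lapMatrix ℝ)) μ → μ ≠ 0 → ε ≤ μ) {t : ℝ}
    (ht : t ∈ quasispectrum ℝ (CStarMatrix.ofMatrix (G.lapMatrix ℂ) : MatAlg V k)) :
    t = 0 ∨ ε ≤ t := by
  have ht' : t ∈ quasispectrum ℝ (G.lapMatrix ℂ) := ht
  rw [quasispectrum_eq_spectrum_union_zero] at ht'
  by_cases h0 : t = 0
  · exact Or.inl h0
  · refine Or.inr (h t (G.hasEigenvalue_lapMatrix_of_mem_spectrum ?_) h0)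
    rcases ht' with ht' | ht'
    · exact ht'
    · exact absurd ht' h0

theorem lapMatrix_mul_kernelProj {k : ℕ} (G : SimpleGraph (V k)) [DecidableRel G.Adj] :
    G.lapMatrix ℂ * kernelProj V k = 0 := by
  ext x y
  have := congrFun (G.lapMatrix_mulVec_const_eq_zero (R := ℂ)) x
  simp only [Matrix.mulVec, dotProduct, mul_one, Pi.zero_apply] at this
  simp [kernelProj, Matrix.mul_apply, ← Finset.sum_mul, this]

theorem kernelProj_mul_of_lapMatrix_mul {k : ℕ} {G : SimpleGraph (V k)} [DecidableRel G.Adj]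
    (hG : G.Connected) {r : Matrix (V k) (V k) ℂ} (hr : G.lapMatrix ℂ * r = 0) :
    kernelProj V k * r = r := by
  have : Nonempty (V k) := hG.nonempty
  ext x y
  have h1 : (G.lapMatrix ℂ).mulVec (fun x => r x y) = 0 := by
    ext x
    exact congrFun (congrFun hr x) y
  have h2 : ∀ z, r z y = r x y := fun z => hG.eq_of_lapMatrix_mulVec_eq_zero G h1 z x
  simp [kernelProj, Matrix.mul_apply, h2]

theorem conjTranspose_kernelProj {V : ℕ → Type v} [∀ k, Fintype (V k)] (k : ℕ) :
    (kernelProj V k).conjTranspose = kernelProj V k := by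
  ext x y
  simp [kernelProj]

theorem kernelProj_mul_self {V : ℕ → Type v} [∀ k, Fintype (V k)] (k : ℕ) :
    kernelProj V k * kernelProj V k = kernelProj V k := by
  ext x y
  have : (Fintype.card (V k) : ℂ) ≠ 0 := by
    have : Nonempty (V k) := ⟨x⟩
    exact_mod_cast Fintype.card_ne_zero
  simp only [kernelProj, Matrix.mul_apply, Matrix.of_apply, Finset.sum_const, Finset.card_univ,
    nsmul_eq_mul]
  field_simp

theorem isSelfAdjoint_lapMatrix {k : ℕ} (G : SimpleGraph (V k)) [DecidableRel G.Adj] :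
    IsSelfAdjoint (CStarMatrix.ofMatrix (G.lapMatrix ℂ) : MatAlg V k) :=
  (G.isHermitian_lapMatrix (R := ℂ) : (G.lapMatrix ℂ).conjTranspose = _)

/-- The Laplacians of a coarsely embedded family define an element of the tensor product. -/
theorem exists_hasComponents_lapMatrix {S : Finset Γ} (hS : Subgroup.closure (S : Set Γ) = ⊤)
    {d : ℕ} {G : ∀ k, SimpleGraph (V k)} [∀ k, DecidableRel (G k).Adj]
    (hG : ∀ k, (G k).IsRegularOfDegree d) (hf : IsCoarseEmbeddingFamily (S : Set Γ) G f) :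
    ∃ z : MinTensor (ProdAlg (MatAlg V)) (RedGroupAlg Γ),
      HasComponents f (fun k => (G k).lapMatrix ℂ) z := by
  obtain ⟨ρ₁, ρ₂, -, -, hρ⟩ := hf
  -- Nonzero off-diagonal entries join adjacent vertices, whose images are at word distance at most
  -- `ρ₂ 1`; word distances are integers, so the floor loses nothing.
  obtain ⟨F, hF⟩ := SimpleGraph.finite_mulCayley_ball S.finite_toSet hS
    ⌊ρ₂ 1⌋₊
  have hsupp : ∀ k x y, (G k).lapMatrix ℂ x y ≠ 0 → x = y ∨ (G k).Adj x y := by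
    intro k x y h
    by_contra! hxy
    simp [SimpleGraph.lapMatrix, SimpleGraph.degMatrix, hxy.1, hxy.2] at h
  -- An entry is a degree term of size at most `d` minus an adjacency term of size at most `1`; a
  -- row is supported on the vertex and its `d` neighbours.
  refine exists_hasComponents f _ F (fun k x y h => hF _ _ ?_) (c := d + 1) (N := d + 1)
    (by positivity) (fun k x y => ?_) (fun k x => insert x ((G k).neighborFinset x))
    (fun k x => ?_) (fun k x y h => ?_)
  · have h1 := Nat.le_floor (hρ k x y).2
    rcases hsupp k x y h with h2 | h2
    · subst h2
      rw [SimpleGraph.dist_self]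
      exact Nat.zero_le _
    · rw [SimpleGraph.dist_eq_one_iff_adj.2 h2, Nat.cast_one] at h1
      exact h1
  · simp only [SimpleGraph.lapMatrix, SimpleGraph.degMatrix, Matrix.sub_apply, Matrix.diagonal_apply,
      SimpleGraph.adjMatrix_apply, (hG k).degree_eq]
    refine (norm_sub_le _ _).trans ?_
    gcongr
    · split_ifs <;> simp
    · split_ifs <;> simp
  · exact (Finset.card_insert_le _ _).trans (by rw [SimpleGraph.card_neighborFinset_eq_degree, hG k x])
  · rcases hsupp k x y h with h2 | h2
    · simp [h2]
    · simp [h2, h2.symm]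

variable {d : ℕ} {G : ∀ k, SimpleGraph (V k)} [∀ k, DecidableRel (G k).Adj]
  {Δ : MinTensor (ProdAlg (MatAlg V)) (RedGroupAlg Γ)}

theorem HasComponents.isSelfAdjoint (hΔ : HasComponents f (fun k => (G k).lapMatrix ℂ) Δ) :
    IsSelfAdjoint Δ := by
  refine HasComponents.unique f (fun k => ?_) hΔ
  rw [map_star, hΔ k, ← iotaMap_star]
  congr 1
  exact (G k).isHermitian_lapMatrix (R := ℂ)

/-- Homomorphisms do not enlarge the quasispectrum, so the gap of the graph Laplacian survives `ι_k`
with the same `ε`. -/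
theorem quasispectrum_iotaMap_lapMatrix {ε : ℝ}
    (h : ∀ (k : ℕ) (μ : ℝ), Module.End.HasEigenvalue (Matrix.toLin' ((G k).lapMatrix ℝ)) μ →
      μ ≠ 0 → ε ≤ μ) {k : ℕ} {t : ℝ}
    (ht : t ∈ quasispectrum ℝ (iotaMap f k ((G k).lapMatrix ℂ))) : t = 0 ∨ ε ≤ t :=
  quasispectrum_lapMatrix (h k) (NonUnitalAlgHom.quasispectrum_apply_subset' ℂ (iotaHom f k)
    (CStarMatrix.ofMatrix ((G k).lapMatrix ℂ)) ht)

/-- The factors separate points, so a continuous function that kills every component of `Δ` kills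
`Δ`, and must then vanish on the quasispectrum of `Δ`. -/
theorem quasispectrum_of_hasComponents_lapMatrix {ε : ℝ}
    (h : ∀ (k : ℕ) (μ : ℝ), Module.End.HasEigenvalue (Matrix.toLin' ((G k).lapMatrix ℝ)) μ →
      μ ≠ 0 → ε ≤ μ) (hε : 0 < ε) (hΔ : HasComponents f (fun k => (G k).lapMatrix ℂ) Δ)
    {t : ℝ} (ht : t ∈ quasispectrum ℝ Δ) : t = 0 ∨ ε ≤ t := by
  have hsa := hΔ.isSelfAdjoint f
  -- A continuous function whose zero set is exactly `{0} ∪ [ε, ∞)`: the first summand detects `(0,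
  -- ε)`, the second the negative axis.
  let g : ℝ → ℝ := fun t => max 0 (t * (ε - t)) + max 0 (-t)
  have hg : Continuous g := by fun_prop
  have hg0 : g 0 = 0 := by simp [g]
  have hz : cfcₙ g Δ = cfcₙ (fun _ : ℝ => (0 : ℝ)) Δ := by
    rw [cfcₙ_const_zero]
    refine eq_zero_of_map_coordHom _ fun k => ?_
    rw [NonUnitalStarAlgHom.map_cfcₙ _ g Δ hg.continuousOn hg0 (continuous_starHom _) hsa
      (hsa.map _), hΔ k, ← cfcₙ_const_zero ℝ (iotaMap f k ((G k).lapMatrix ℂ))]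
    refine cfcₙ_congr fun s hs => ?_
    rcases quasispectrum_iotaMap_lapMatrix f h hs with rfl | h1
    · exact hg0
    · have h2 : s * (ε - s) ≤ 0 := mul_nonpos_of_nonneg_of_nonpos (hε.le.trans h1) (by linarith)
      have h3 : -s ≤ 0 := by linarith
      simp [g, h2, h3]
  have h1 : g t = 0 := eqOn_of_cfcₙ_eq_cfcₙ hz hsa hg.continuousOn hg0 continuousOn_const rfl ht
  have h2 : 0 ≤ max 0 (t * (ε - t)) := le_max_left _ _
  have h3 : 0 ≤ max 0 (-t) := le_max_left _ _
  have h4 : t * (ε - t) ≤ max 0 (t * (ε - t)) := le_max_right _ _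
  have h5 : -t ≤ max 0 (-t) := le_max_right _ _
  have h6 : max 0 (t * (ε - t)) + max 0 (-t) = 0 := h1
  have h7 : 0 ≤ t := by linarith
  rcases h7.eq_or_lt with h8 | h8
  · exact Or.inl h8.symm
  · refine Or.inr ?_
    by_contra! h9
    have := mul_pos h8 (sub_pos.2 h9)
    linarith

theorem hasComponents_kernelProj {ε : ℝ}
    (h : ∀ (k : ℕ) (μ : ℝ), Module.End.HasEigenvalue (Matrix.toLin' ((G k).lapMatrix ℝ)) μ →
      μ ≠ 0 → ε ≤ μ) (hε : 0 < ε) (hG : ∀ k, (G k).Connected)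
    (hΔ : HasComponents f (fun k => (G k).lapMatrix ℂ) Δ) :
    HasComponents f (kernelProj V)
      (tensorOne V Γ - cfcₙ (fun t : ℝ => if t = 0 then 0 else 1) Δ) := by
  intro k
  rw [map_sub, tensorOne_hasComponents f k, map_cfcₙ_indicator _ hε (hΔ.isSelfAdjoint f)
    (fun t => quasispectrum_of_hasComponents_lapMatrix f h hε hΔ), hΔ k]
  refine map_sub_cfcₙ_indicator_eq (iotaHom f k) hε (isSelfAdjoint_lapMatrix (V := V) (G k))
    (fun t => quasispectrum_lapMatrix (h k)) (fun z => ?_) ?_ ?_ ?_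
  · exact ⟨Matrix.one_mul (CStarMatrix.ofMatrix.symm z), Matrix.mul_one (CStarMatrix.ofMatrix.symm z)⟩
  · exact conjTranspose_kernelProj (V := V) k
  · exact lapMatrix_mul_kernelProj (G k)
  · exact fun r hr => kernelProj_mul_of_lapMatrix_mul (hG k) (r := CStarMatrix.ofMatrix.symm r) hr

theorem HasComponents.isStarProjection {q : MinTensor (ProdAlg (MatAlg V)) (RedGroupAlg Γ)}
    (hq : HasComponents f (kernelProj V) q) : IsStarProjection q := by
  refine ⟨HasComponents.unique f (fun k => ?_) hq, HasComponents.unique f (fun k => ?_) hq⟩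
  · rw [map_mul, hq k, ← iotaMap_mul, kernelProj_mul_self]
  · rw [map_star, hq k, ← iotaMap_star, conjTranspose_kernelProj]

end Laplacian

/-! ### Vanishing of `q` over the quotient by the direct sum. -/

section Quotient
variable {Γ : Type u} [Group Γ] {V : ℕ → Type v} [∀ k, Fintype (V k)] [∀ k, DecidableEq (V k)]
  (f : ∀ k, V k → Γ)

/-- The maps of a coarse embedding of graphs of bounded degree have uniformly bounded fibres. -/
theorem IsCoarseEmbeddingFamily.exists_card_fibre_le {V : ℕ → Type v} [∀ k, Fintype (V k)] {S : Set Γ} {d : ℕ} {G : ∀ k, SimpleGraph (V k)}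
    [∀ k, DecidableRel (G k).Adj] (hG : ∀ k, (G k).IsRegularOfDegree d)
    (hc : ∀ k, (G k).Connected) {f : ∀ k, V k → Γ} (hf : IsCoarseEmbeddingFamily S G f) :
    ∃ N : ℕ, ∀ (k : ℕ) (s : Finset (V k)), (∀ x ∈ s, ∀ y ∈ s, f k x = f k y) → s.card ≤ N := by
  classical
  obtain ⟨ρ₁, ρ₂, h1, -, hρ⟩ := hf
  -- Beyond distance `R` the lower control function is positive, so vertices with the same image are
  -- closer than `R`, and a fibre lies in a ball of radius `⌈R⌉₊`.
  obtain ⟨R, hR⟩ := (h1.eventually_gt_atTop 0).exists_forall_of_atTop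
  refine ⟨∑ n ∈ Finset.range ⌈R⌉₊, d ^ n, fun k s hs => ?_⟩
  rcases s.eq_empty_or_nonempty with rfl | ⟨x, hx⟩
  · simp
  · refine (Finset.card_le_card fun y hy => ?_).trans ((hG k).card_ball_le (G k) (hc k) ⌈R⌉₊ x)
    simp only [Finset.mem_filter, Finset.mem_univ, true_and]
    by_contra! h
    have h2 := hR ((G k).dist x y) ((Nat.le_ceil R).trans (by exact_mod_cast h))
    have h3 := (hρ k x y).1
    rw [hs x hx y hy, SimpleGraph.dist_self, Nat.cast_zero] at h3
    exact absurd h2 h3.not_gt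

/-- With `x` and `g` fixed, `f(x)⁻¹f(y) = g` determines `f(y)`, so each row meets one fibre of `f`;
the same holds for columns. At most `N` entries `1/n_k` remain in each. -/
theorem norm_diagonalPart_kernelProj_le {N : ℕ}
    (hN : ∀ (k : ℕ) (s : Finset (V k)), (∀ x ∈ s, ∀ y ∈ s, f k x = f k y) → s.card ≤ N)
    (g : Γ) (k : ℕ) :
    ‖(CStarMatrix.ofMatrix (diagonalPart f (kernelProj V) g k) : MatAlg V k)‖ ≤
      N * (Fintype.card (V k) : ℝ)⁻¹ := by
  classical
  have hne : ∀ x y, diagonalPart f (kernelProj V) g k x y ≠ 0 → (f k x)⁻¹ * f k y = g := by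
    intro x y h
    by_contra h0
    simp [diagonalPart, h0] at h
  refine norm_ofMatrix_le_of_card k _ (by positivity) (fun x y => ?_)
    (fun x => Finset.univ.filter fun y => (f k x)⁻¹ * f k y = g)
    (fun y => Finset.univ.filter fun x => (f k x)⁻¹ * f k y = g)
    (fun x => hN k _ fun y hy z hz => ?_) (fun y => hN k _ fun x hx z hz => ?_)
    (fun x y h => by simpa using hne x y h) (fun x y h => by simpa using hne x y h)
  · simp only [diagonalPart, kernelProj, Matrix.of_apply]
    split_ifs <;> simp
  · simp only [Finset.mem_filter, Finset.mem_univ, true_and] at hy hz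
    exact mul_left_cancel (hy.trans hz.symm)
  · simp only [Finset.mem_filter, Finset.mem_univ, true_and] at hx hz
    exact inv_injective (mul_right_cancel (hx.trans hz.symm))

/-- The coefficient `⟨δ_t, λ(g)δ_s⟩` is `1` for `g = ts⁻¹` and `0` otherwise, so slicing at point
masses picks out a single label. -/
theorem matSlice_pointMass {T : ∀ k, Matrix (V k) (V k) ℂ}
    {z : MinTensor (ProdAlg (MatAlg V)) (RedGroupAlg Γ)} (hz : HasComponents f T z) (s t : Γ) (k : ℕ) :
    matSlice (regRep Γ) (pointMass s) (pointMass t) z k =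
      CStarMatrix.ofMatrix (diagonalPart f T (t * s⁻¹) k) := by
  classical
  have h0 : matSlice (regRep Γ) (pointMass s) (pointMass t) z k = matOf V k
    (sliceR (stdRep V k, regRep Γ) (pointMass s) (pointMass t)
      (MinTensor.map (RedGroupAlg Γ) (coordHom (MatAlg V) k) z)) := rfl
  -- All labels that occur, together with `t * s⁻¹`, whose term is needed even when its diagonal
  -- part is zero.
  let F : Finset Γ := insert (t * s⁻¹)
    (Finset.image (fun p : V k × V k => (f k p.1)⁻¹ * f k p.2) Finset.univ)
  rw [h0, hz k, iotaMap_eq_sum_diagonalPart f T F k fun x y _ => Finset.mem_insert_of_mem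
    (Finset.mem_image.2 ⟨(x, y), Finset.mem_univ _, rfl⟩), map_sum,
    Finset.sum_eq_single_of_mem (t * s⁻¹) (Finset.mem_insert_self _ _)]
  · have h1 : (inner ℂ (pointMass t) ((regRep Γ).hom (RedGroupAlg.of (t * s⁻¹)) (pointMass s)) : ℂ) = 1 := by
      change (inner ℂ (pointMass t) (leftRegular (t * s⁻¹) (pointMass s)) : ℂ) = 1
      rw [leftRegular_pointMass, inner_pointMass, pointMass_apply]
      simp
    rw [sliceR_tmul, h1, one_smul]
    exact matOf_matHom k _
  · intro g _ hg
    have h1 : (inner ℂ (pointMass t) ((regRep Γ).hom (RedGroupAlg.of g) (pointMass s)) : ℂ) = 0 := by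
      change (inner ℂ (pointMass t) (leftRegular g (pointMass s)) : ℂ) = 0
      rw [leftRegular_pointMass, inner_pointMass, pointMass_apply, if_neg]
      rintro rfl
      exact hg (by group)
    rw [sliceR_tmul, h1, zero_smul]

/-- The projection `q` is annihilated by the passage to the quotient by the direct sum. -/
theorem map_mkHom_kernelProj {N : ℕ}
    (hN : ∀ (k : ℕ) (s : Finset (V k)), (∀ x ∈ s, ∀ y ∈ s, f k x = f k y) → s.card ≤ N)
    (hcard : Tendsto (fun k => Fintype.card (V k)) atTop atTop)
    {q : MinTensor (ProdAlg (MatAlg V)) (RedGroupAlg Γ)} (hq : HasComponents f (kernelProj V) q) :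
    MinTensor.map (RedGroupAlg Γ) (QuotAlg.mkHom (MatAlg V)) q = 0 := by
  refine eq_zero_of_inner_pointMass _ fun π ξ ξ' s t => ?_
  have hmem : matSlice (regRep Γ) (pointMass s) (pointMass t) q ∈ sumIdeal (MatAlg V) := by
    have hlim : Tendsto (fun k => (N : ℝ) * (Fintype.card (V k) : ℝ)⁻¹) atTop (𝓝 0) := by
      simpa using ((tendsto_inv_atTop_zero.comp
        (tendsto_natCast_atTop_atTop.comp hcard)).const_mul (N : ℝ))
    refine squeeze_zero (fun _ => norm_nonneg _) (fun k => ?_) hlim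
    rw [matSlice_pointMass f hq]
    exact norm_diagonalPart_kernelProj_le f hN _ k
  have h0 : QuotAlg.mkHom (MatAlg V) (matSlice (regRep Γ) (pointMass s) (pointMass t) q) = 0 := by
    refine (QuotAlg.mk_eq_mk (y := 0)).2 ?_
    rwa [sub_zero]
  -- A representation of the quotient is pulled back to the product, where the coefficient is
  -- expressed through the slice of `q`; that slice lies in the direct sum and is killed.
  refine (inner_rep_eq_matSlice (π.comap (QuotAlg.mkHom (MatAlg V)), regRep Γ) q ξ ξ'
    (pointMass s) (pointMass t)).trans ?_
  change (inner ℂ ξ' (π.hom (QuotAlg.mkHom (MatAlg V)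
    (matSlice (regRep Γ) (pointMass s) (pointMass t) q)) ξ) : ℂ) = 0
  rw [h0, map_zero, zero_apply, inner_zero_right]

end Quotient

/-! ### Close idempotents are similar. -/

section IdempotentTrace

/-- The element `sp + (1 - s)(1 - p)` is an inverse up to the factor `1 - (p - s)²`, on either side,
and that factor is invertible by the Neumann series. The intertwiner `z` satisfies `pz = ps = zs`,
so it conjugates `s` to `p`. -/
theorem isUnit_intertwiner {R : Type*} [NormedRing R] [CompleteSpace R] {p s : R}
    (hp : p * p = p) (hs : s * s = s) (h : ‖p - s‖ < 1) : IsUnit (p * s + (1 - p) * (1 - s)) := by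
  have h1 : (p * s + (1 - p) * (1 - s)) * (s * p + (1 - s) * (1 - p)) = 1 - (p - s) * (p - s) := by
    simp only [mul_add, add_mul, mul_sub, sub_mul, mul_one, one_mul, mul_assoc, hp, hs,
      ← mul_assoc s s]
    abel
  have h2 : (s * p + (1 - s) * (1 - p)) * (p * s + (1 - p) * (1 - s)) = 1 - (p - s) * (p - s) := by
    simp only [mul_add, add_mul, mul_sub, sub_mul, mul_one, one_mul, mul_assoc, hp, hs,
      ← mul_assoc p p]
    abel
  have h3 : IsUnit (1 - (p - s) * (p - s)) := by
    refine isUnit_one_sub_of_norm_lt_one ((norm_mul_le _ _).trans_lt ?_)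
    exact mul_lt_one_of_nonneg_of_lt_one_left (norm_nonneg _) h h.le
  rw [← h1] at h3
  exact ((Commute.isUnit_mul_iff (h1.trans h2.symm)).1 h3).1

/-- Idempotents at distance less than one have the same trace. -/
theorem trace_eq_of_norm_sub_lt {R : Type*} [NormedRing R] [CompleteSpace R] {p s : R}
    (hp : p * p = p) (hs : s * s = s) (h : ‖p - s‖ < 1) {G : Type*} (t : R → G)
    (ht : ∀ a b, t (a * b) = t (b * a)) : t p = t s := by
  obtain ⟨z, hz⟩ := isUnit_intertwiner hp hs h
  have h1 : p * z = z * s := by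
    rw [hz]
    simp only [mul_add, add_mul, mul_sub, sub_mul, mul_one, one_mul, mul_assoc, hs,
      ← mul_assoc p p, hp]
    abel
  calc t p = t ((p * z) * ↑z⁻¹) := by rw [mul_assoc, Units.mul_inv, mul_one]
    _ = t (↑z⁻¹ * (z * s)) := by rw [ht, h1]
    _ = t s := by rw [← mul_assoc, Units.inv_mul, one_mul]

end IdempotentTrace

/-! ### Homomorphisms from `K₀` defined by traces. -/

section TraceOnKTheory
open Matrix

section Unital
variable {R : Type u} [Ring R] (t : R →+ ℂ)

/-- The extension of a functional to matrices. -/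
def matTrace {n : Type*} [Fintype n] (a : Matrix n n R) : ℂ := ∑ i, t (a i i)

theorem matTrace_mul_comm (ht : ∀ a b, t (a * b) = t (b * a)) {m n : Type*} [Fintype m] [Fintype n]
    (a : Matrix m n R) (b : Matrix n m R) : matTrace t (a * b) = matTrace t (b * a) := by
  simp only [matTrace, Matrix.mul_apply, map_sum]
  rw [Finset.sum_comm]
  exact Finset.sum_congr rfl fun i _ => Finset.sum_congr rfl fun j _ => ht _ _

variable [StarRing R]

/-- The homomorphism on classes of projections defined by a trace. -/
def ProjClass.trace (ht : ∀ a b, t (a * b) = t (b * a)) : ProjClass R →+ ℂ where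
  toFun := Quotient.lift (fun p => matTrace t p.mat) fun p q h => by
    obtain ⟨v, h1, h2, -, -⟩ := h
    rw [← h1, ← h2]
    exact matTrace_mul_comm t ht _ _
  map_zero' := by
    change matTrace t (0 : Matrix (Fin 0) (Fin 0) R) = 0
    simp [matTrace]
  map_add' a b := by
    induction a using Quotient.inductionOn with | _ p
    induction b using Quotient.inductionOn with | _ q
    change matTrace t ((fromBlocks p.mat 0 0 q.mat).submatrix finSumFinEquiv.symm finSumFinEquiv.symm) =
      matTrace t p.mat + matTrace t q.mat
    simp only [matTrace, Matrix.submatrix_apply]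
    rw [Equiv.sum_comp finSumFinEquiv.symm fun i => t (fromBlocks p.mat 0 0 q.mat i i),
      Fintype.sum_sum_type]
    rfl

theorem ProjClass.trace_cls (ht : ∀ a b, t (a * b) = t (b * a)) (p : ProjMat R) :
    ProjClass.trace t ht p.cls = matTrace t p.mat := rfl

/-- The homomorphism on `K₀` defined by a trace. -/
def K0Unital.trace (ht : ∀ a b, t (a * b) = t (b * a)) : K0Unital R →+ ℂ :=
  Algebra.GrothendieckAddGroup.lift (ProjClass.trace t ht)

theorem K0Unital.trace_of (ht : ∀ a b, t (a * b) = t (b * a)) (x : ProjClass R) :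
    K0Unital.trace t ht (K0Unital.of x) = ProjClass.trace t ht x :=
  DFunLike.congr_fun (Algebra.GrothendieckAddGroup.lift.symm_apply_apply (ProjClass.trace t ht)) x

/-- Every element of `K₀` is a difference of classes of projections. -/
theorem K0Unital.exists_eq_sub (x : K0Unital R) :
    ∃ p q : ProjMat R, x = K0Unital.of p.cls - K0Unital.of q.cls := by
  let H : AddSubgroup (K0Unital R) :=
    { carrier := {x | ∃ a b : ProjClass R, x = K0Unital.of a - K0Unital.of b}
      add_mem' := by
        rintro _ _ ⟨a, b, rfl⟩ ⟨a', b', rfl⟩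
        exact ⟨a + a', b + b', by rw [map_add, map_add]; abel⟩
      zero_mem' := ⟨0, 0, by rw [sub_self]⟩
      neg_mem' := by
        rintro _ ⟨a, b, rfl⟩
        exact ⟨b, a, by rw [neg_sub]⟩ }
  -- The differences form a subgroup `H`. The quotient map by `H` kills all classes of projections,
  -- so it is zero by the universal property and `H` is everything.
  have h1 : QuotientAddGroup.mk' H = 0 := K0Unital.hom_ext fun a =>
    (QuotientAddGroup.eq_zero_iff _).2 ⟨a, 0, by rw [map_zero, sub_zero]⟩
  obtain ⟨a, b, hab⟩ := (QuotientAddGroup.eq_zero_iff x).1 (DFunLike.congr_fun h1 x)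
  induction a using Quotient.inductionOn with | _ p
  induction b using Quotient.inductionOn with | _ q
  exact ⟨p, q, hab⟩

end Unital

section NonUnital
variable {A : Type u} {B : Type v} [NonUnitalCStarAlgebra A] [NonUnitalCStarAlgebra B]

/-- The extension of a functional to the unitization, by zero on the unit. -/
def sndTrace (τ : A →+ ℂ) : Unitization ℂ A →+ ℂ where
  toFun x := τ x.snd
  map_zero' := map_zero τ
  map_add' x y := map_add τ x.snd y.snd

theorem sndTrace_mul_comm {τ : A →+ ℂ} (hτ : ∀ a b, τ (a * b) = τ (b * a)) (x y : Unitization ℂ A) :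
    sndTrace τ (x * y) = sndTrace τ (y * x) := by
  change τ (x.fst • y.snd + y.fst • x.snd + x.snd * y.snd) =
    τ (y.fst • x.snd + x.fst • y.snd + y.snd * x.snd)
  rw [map_add, hτ x.snd, ← map_add, add_comm (y.fst • x.snd)]

/-- The homomorphism on `K₀` defined by a trace. -/
def K0.trace (τ : A →+ ℂ) (hτ : ∀ a b, τ (a * b) = τ (b * a)) : K0 A →+ ℂ :=
  (K0Unital.trace (sndTrace τ) (sndTrace_mul_comm hτ)).comp
    (K0Unital.map (scalarPart A)).ker.subtype

theorem K0.trace_cls (τ : A →+ ℂ) (hτ : ∀ a b, τ (a * b) = τ (b * a)) (p : A)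
    (hp : IsStarProjection p) : K0.trace τ hτ (K0.cls p hp) = τ p := by
  change K0Unital.trace (sndTrace τ) (sndTrace_mul_comm hτ) (K0Unital.of (ProjMat.ofProj p hp).cls) = _
  rw [K0Unital.trace_of, ProjClass.trace_cls]
  change ∑ i : Fin 1, sndTrace τ (p : Unitization ℂ A) = τ p
  rw [Fin.sum_univ_one]
  rfl

theorem K0.map_cls (φ : A →⋆ₙₐ[ℂ] B) (p : A) (hp : IsStarProjection p) :
    K0.map φ (K0.cls p hp) = K0.cls (φ p) (hp.map φ) := by
  refine Subtype.ext ?_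
  change K0Unital.map (Unitization.starMap φ) (K0Unital.of (ProjMat.ofProj p hp).cls) =
    K0Unital.of (ProjMat.ofProj (φ p) (hp.map φ)).cls
  rw [K0Unital.map_of]
  congr 1
  refine congrArg ProjMat.cls (ProjMat.mk_congr ?_ _ _)
  ext i j : 1
  exact Unitization.starMap_inr φ p

theorem K0.cls_zero (hp : IsStarProjection (0 : A)) : K0.cls 0 hp = 0 := by
  refine Subtype.ext ?_
  change K0Unital.of (ProjMat.ofProj (0 : A) hp).cls = 0
  rw [← map_zero K0Unital.of]
  congr 1
  refine Quotient.sound ?_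
  change MvN (Matrix.of fun _ _ : Fin 1 => ((0 : A) : Unitization ℂ A))
    (0 : Matrix (Fin 0) (Fin 0) (Unitization ℂ A))
  have h0 : (Matrix.of fun _ _ : Fin 1 => ((0 : A) : Unitization ℂ A)) = 0 := by
    ext i j : 1
    exact Unitization.inr_zero ℂ
  rw [h0]
  exact .zero

theorem K0.map_map {C : Type w} [NonUnitalCStarAlgebra C] (φ : A →⋆ₙₐ[ℂ] B) (ψ : B →⋆ₙₐ[ℂ] C)
    (x : K0 A) : K0.map ψ (K0.map φ x) = K0.map (ψ.comp φ) x := by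
  refine Subtype.ext ?_
  change K0Unital.map (Unitization.starMap ψ) (K0Unital.map (Unitization.starMap φ) x.1) =
    K0Unital.map (Unitization.starMap (ψ.comp φ)) x.1
  rw [K0Unital.map_map, Unitization.starMap_comp]

attribute [local instance] Matrix.linftyOpNormedRing in
theorem linfty_opNorm_le_sum {R : Type*} [NormedRing R] {n : Type*} [Fintype n] [DecidableEq n]
    (a : Matrix n n R) : ‖a‖ ≤ ∑ i, ∑ j, ‖a i j‖ := by
  have : ‖a‖₊ ≤ ∑ i, ∑ j, ‖a i j‖₊ := by
    rw [Matrix.linfty_opNNNorm_def]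
    exact Finset.sup_le fun i _ =>
      Finset.single_le_sum (f := fun i => ∑ j, ‖a i j‖₊) (fun _ _ => zero_le) (Finset.mem_univ i)
  simpa only [coe_nnnorm, NNReal.coe_sum] using NNReal.coe_le_coe.2 this

-- The image of `p` and its scalar part are idempotents that differ by the matrix of the `φ (p i
-- j).snd`. If this is small they are similar, and a scalar matrix has trace zero for the extension
-- vanishing on the unit. Similarity needs only a complete submultiplicative norm on matrices, hence
-- the row-sum norm rather than the C*-norm.
attribute [local instance] Matrix.linftyOpNormedRing in
theorem matTrace_map_eq_zero (φ : A →⋆ₙₐ[ℂ] B) (τ : B →+ ℂ) (hτ : ∀ a b, τ (a * b) = τ (b * a))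
    {n : ℕ} {p : Matrix (Fin n) (Fin n) (Unitization ℂ A)} (hp : p * p = p)
    (h : ∑ i, ∑ j, ‖φ (p i j).snd‖ < 1) :
    matTrace (sndTrace τ) (p.map (Unitization.starMap φ)) = 0 := by
  let s : Matrix (Fin n) (Fin n) (Unitization ℂ B) :=
    (p.map (scalarPart A)).map (algebraMap ℂ (Unitization ℂ B))
  have hs : s * s = s := by
    rw [← Matrix.map_mul, ← Matrix.map_mul, hp]
  have hp' : p.map (Unitization.starMap φ) * p.map (Unitization.starMap φ) =
      p.map (Unitization.starMap φ) := by rw [← Matrix.map_mul, hp]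
  have hentry : ∀ i j, ‖(p.map (Unitization.starMap φ) - s) i j‖ = ‖φ (p i j).snd‖ := by
    intro i j
    have : (p.map (Unitization.starMap φ) - s) i j = ((φ (p i j).snd : B) : Unitization ℂ B) := by
      refine Unitization.ext ?_ ?_
      · simp [s]
      · simp [s]
    rw [this, Unitization.norm_inr]
  have hnorm : ‖p.map (Unitization.starMap φ) - s‖ < 1 := by
    refine lt_of_le_of_lt ?_ h
    simp only [← hentry]
    exact linfty_opNorm_le_sum _
  rw [@trace_eq_of_norm_sub_lt (Matrix (Fin n) (Fin n) (Unitization ℂ B)) _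
    (inferInstanceAs (CompleteSpace (Fin n → Fin n → Unitization ℂ B)))
    _ _ hp' hs hnorm _ (matTrace (sndTrace τ))
    (fun a b => matTrace_mul_comm _ (sndTrace_mul_comm hτ) a b)]
  refine Finset.sum_eq_zero fun i _ => ?_
  change τ (algebraMap ℂ (Unitization ℂ B) _).snd = 0
  rw [Unitization.algebraMap_eq_inl, Unitization.snd_inl, map_zero]

/-- Homomorphisms tending to zero pointwise eventually annihilate every class in `K₀`, up to
elements of trace zero. -/
theorem K0.eventually_trace_map_eq_zero {B : ℕ → Type v} [∀ k, NonUnitalCStarAlgebra (B k)]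
    (φ : ∀ k, A →⋆ₙₐ[ℂ] B k) (hφ : ∀ a, Tendsto (fun k => ‖φ k a‖) atTop (𝓝 0))
    (τ : ∀ k, B k →+ ℂ) (hτ : ∀ k a b, τ k (a * b) = τ k (b * a)) (y : K0 A) :
    ∀ᶠ k in atTop, K0.trace (τ k) (hτ k) (K0.map (φ k) y) = 0 := by
  have key : ∀ p : ProjMat (Unitization ℂ A), ∀ᶠ k in atTop,
      matTrace (sndTrace (τ k)) (p.mat.map (Unitization.starMap (φ k))) = 0 := by
    intro p
    have hlim : Tendsto (fun k => ∑ i, ∑ j, ‖φ k (p.mat i j).snd‖) atTop (𝓝 0) := by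
      simpa using tendsto_finsetSum Finset.univ fun i _ =>
        tendsto_finsetSum Finset.univ fun j _ => hφ (p.mat i j).snd
    filter_upwards [hlim.eventually (gt_mem_nhds zero_lt_one)] with k hk
    exact matTrace_map_eq_zero (φ k) (τ k) (hτ k) p.isProj.isIdempotentElem hk
  obtain ⟨p, q, hpq⟩ := K0Unital.exists_eq_sub y.1
  filter_upwards [key p, key q] with k hp hq
  change K0Unital.trace (sndTrace (τ k)) (sndTrace_mul_comm (hτ k))
    (K0Unital.map (Unitization.starMap (φ k)) y.1) = 0
  rw [hpq, map_sub, map_sub, K0Unital.map_of, K0Unital.map_of, K0Unital.trace_of, K0Unital.trace_of]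
  change matTrace (sndTrace (τ k)) (p.mat.map (Unitization.starMap (φ k))) -
    matTrace (sndTrace (τ k)) (q.mat.map (Unitization.starMap (φ k))) = 0
  rw [hp, hq, sub_zero]

end NonUnital
end TraceOnKTheory

/-! ### The canonical trace of the reduced group algebra. -/

section GroupTrace
variable {Γ : Type u} [Group Γ]

namespace RedGroupAlg

theorem induction_on {p : RedGroupAlg Γ → Prop} (z : RedGroupAlg Γ) (closed : IsClosed {z | p z})
    (smul_of : ∀ (r : ℂ) g, p (r • of g)) (add : ∀ x y, p x → p y → p (x + y)) : p z := by
  let s : Set (EllTwo Γ →L[ℂ] EllTwo Γ) := Set.range fun q : ℂ × Γ => q.1 • leftRegular q.2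
  have hmul : ∀ (r t : ℂ) (g h : Γ),
      (r • leftRegular g) * (t • leftRegular h) = (r * t) • leftRegular (g * h) := by
    intro r t g h
    rw [smul_mul_smul_comm]
    exact congrArg _ (congrArg Subtype.val (of_mul g h))
  have hstar : ∀ (r : ℂ) (g : Γ), star (r • leftRegular g) = star r • leftRegular g⁻¹ := by
    intro r g
    rw [star_smul]
    exact congrArg _ (congrArg Subtype.val (star_of g))
  let K : NonUnitalStarSubalgebra ℂ (EllTwo Γ →L[ℂ] EllTwo Γ) :=
    { AddSubmonoid.closure s with
      mul_mem' := fun {x y} hx hy => by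
        change x * y ∈ AddSubmonoid.closure _
        induction hx, hy using AddSubmonoid.closure_induction₂ with
        | mem x y hx hy =>
          obtain ⟨p, rfl⟩ := hx
          obtain ⟨q, rfl⟩ := hy
          exact AddSubmonoid.subset_closure ⟨(p.1 * q.1, p.2 * q.2), (hmul _ _ _ _).symm⟩
        | zero_left => rw [zero_mul]; exact zero_mem _
        | zero_right => rw [mul_zero]; exact zero_mem _
        | add_left _ _ _ _ _ _ h1 h2 => rw [add_mul]; exact add_mem h1 h2
        | add_right _ _ _ _ _ _ h1 h2 => rw [mul_add]; exact add_mem h1 h2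
      smul_mem' := fun r x hx => by
        change r • x ∈ AddSubmonoid.closure _
        induction hx using AddSubmonoid.closure_induction with
        | mem x hx =>
          obtain ⟨q, rfl⟩ := hx
          exact AddSubmonoid.subset_closure ⟨(r * q.1, q.2), mul_smul _ _ _⟩
        | zero => rw [smul_zero]; exact zero_mem _
        | add _ _ _ _ h1 h2 => rw [smul_add]; exact add_mem h1 h2
      star_mem' := fun {x} hx => by
        change star x ∈ AddSubmonoid.closure _
        induction hx using AddSubmonoid.closure_induction with
        | mem x hx =>
          obtain ⟨q, rfl⟩ := hx
          exact AddSubmonoid.subset_closure ⟨(star q.1, q.2⁻¹), (hstar _ _).symm⟩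
        | zero => rw [star_zero]; exact zero_mem _
        | add _ _ _ _ h1 h2 => rw [star_add]; exact add_mem h1 h2 }
  have hle : NonUnitalStarAlgebra.adjoin ℂ (Set.range (leftRegular (Γ := Γ))) ≤ K := by
    refine NonUnitalStarAlgebra.adjoin_le ?_
    rintro _ ⟨g, rfl⟩
    exact AddSubmonoid.subset_closure ⟨(1, g), one_smul _ _⟩
  have hmem : ∀ x ∈ AddSubmonoid.closure s, ∃ w : RedGroupAlg Γ, w.1 = x ∧ p w := by
    intro x hx
    induction hx using AddSubmonoid.closure_induction with
    | mem x hx =>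
      obtain ⟨q, rfl⟩ := hx
      exact ⟨_, rfl, smul_of q.1 q.2⟩
    | zero => exact ⟨0, rfl, by simpa using smul_of 0 1⟩
    | add _ _ _ _ h1 h2 =>
      obtain ⟨w, rfl, hw⟩ := h1
      obtain ⟨w', rfl, hw'⟩ := h2
      exact ⟨w + w', rfl, add _ _ hw hw'⟩
  have hz : z ∈ closure {z : RedGroupAlg Γ | p z} := by
    refine closure_subtype.2 (closure_mono (fun x hx => ?_) z.2)
    obtain ⟨w, rfl, hw⟩ := hmem x (hle hx)
    exact ⟨w, hw, rfl⟩
  exact closed.closure_subset hz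

/-- The canonical trace `c ↦ ⟨δ₁, c δ₁⟩`. -/
def trace (c : RedGroupAlg Γ) : ℂ := inner ℂ (pointMass 1) ((regRep Γ).hom c (pointMass 1))

open scoped Classical in
theorem trace_of (g : Γ) : trace (of g) = if g = 1 then 1 else 0 := by
  change (inner ℂ (pointMass 1) (leftRegular g (pointMass 1)) : ℂ) = _
  rw [leftRegular_pointMass, inner_pointMass, pointMass_apply, mul_one]
  exact if_congr eq_comm rfl rfl

theorem trace_add (c d : RedGroupAlg Γ) : trace (c + d) = trace c + trace d := by
  rw [trace, map_add, add_apply, inner_add_right]; rfl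

theorem trace_smul (r : ℂ) (c : RedGroupAlg Γ) : trace (r • c) = r * trace c := by
  rw [trace, map_smul, smul_apply, inner_smul_right]; rfl

theorem continuous_trace : Continuous (trace (Γ := Γ)) := by
  have h1 : Continuous (regRep Γ).hom := continuous_starHom (regRep Γ).hom
  have h2 : Continuous fun c => (regRep Γ).hom c (pointMass 1) := h1.clm_apply continuous_const
  exact continuous_const.inner h2

/-- By density and linearity this reduces to group elements, where `gh = 1` if and only if `hg = 1`.
-/
theorem trace_mul_comm (c d : RedGroupAlg Γ) : trace (c * d) = trace (d * c) := by
  induction c using induction_on with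
  | closed =>
    exact isClosed_eq (continuous_trace.comp (continuous_id.mul continuous_const))
      (continuous_trace.comp (continuous_const.mul continuous_id))
  | add x y hx hy => rw [add_mul, mul_add, trace_add, trace_add, hx, hy]
  | smul_of r g =>
    induction d using induction_on with
    | closed =>
      exact isClosed_eq (continuous_trace.comp (continuous_const.mul continuous_id))
        (continuous_trace.comp (continuous_id.mul continuous_const))
    | add x y hx hy => rw [add_mul, mul_add, trace_add, trace_add, hx, hy]
    | smul_of t h =>
      classical
      rw [smul_mul_smul_comm, smul_mul_smul_comm, trace_smul, trace_smul, of_mul, of_mul, trace_of,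
        trace_of, mul_comm r t]
      congr 1
      exact if_congr mul_eq_one_comm rfl rfl

end RedGroupAlg

end GroupTrace

/-! ### The traces `Tr ⊗ τ` on the factors. -/

section FactorTrace
variable {Γ : Type u} [Group Γ] {V : ℕ → Type v} [∀ k, Fintype (V k)] [∀ k, DecidableEq (V k)]

/-- The slice map `id ⊗ τ` on a matrix algebra over the reduced group C*-algebra, where `τ` is the
canonical trace. -/
def traceSlice (V : ℕ → Type v) [∀ k, Fintype (V k)] [∀ k, DecidableEq (V k)] (Γ : Type u) [Group Γ]
    (k : ℕ) : MinTensor (MatAlg V k) (RedGroupAlg Γ) →ₗ[ℂ] MatAlg V k :=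
  (matOf V k).comp (sliceR (stdRep V k, regRep Γ) (pointMass 1) (pointMass 1))

theorem traceSlice_tmul (k : ℕ) (a : MatAlg V k) (c : RedGroupAlg Γ) :
    traceSlice V Γ k (MinTensor.tmul a c) = RedGroupAlg.trace c • a := by
  change matOf V k (sliceR (stdRep V k, regRep Γ) (pointMass 1) (pointMass 1) _) = _
  rw [sliceR_tmul]
  refine (map_smul (matOf V k) _ _).trans ?_
  exact congrArg _ (matOf_matHom k a)

theorem continuous_traceSlice (k : ℕ) : Continuous (traceSlice V Γ k) :=
  AddMonoidHomClass.continuous_of_bound (traceSlice V Γ k) _ fun z =>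
    (norm_matOf k _).trans_le (norm_sliceR_le (stdRep V k, regRep Γ) (pointMass 1) (pointMass 1) z)

/-- The trace `Tr ⊗ τ` on a matrix algebra over the reduced group C*-algebra. -/
def factorTrace (V : ℕ → Type v) [∀ k, Fintype (V k)] [∀ k, DecidableEq (V k)] (Γ : Type u) [Group Γ]
    (k : ℕ) : MinTensor (MatAlg V k) (RedGroupAlg Γ) →+ ℂ where
  toFun z := ∑ x, traceSlice V Γ k z x x
  map_zero' := by simp
  map_add' z w := by
    rw [map_add, ← Finset.sum_add_distrib]
    rfl

theorem factorTrace_tmul (k : ℕ) (a : MatAlg V k) (c : RedGroupAlg Γ) :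
    factorTrace V Γ k (MinTensor.tmul a c) = RedGroupAlg.trace c * ∑ x, a x x := by
  change ∑ x, traceSlice V Γ k (MinTensor.tmul a c) x x = _
  rw [traceSlice_tmul, Finset.mul_sum]
  rfl

theorem continuous_factorTrace (k : ℕ) : Continuous (factorTrace V Γ k) := by
  refine continuous_finsetSum _ fun x _ => ?_
  have h : Continuous fun a : MatAlg V k => a x x :=
    (AddMonoidHomClass.continuous_of_bound
      ({ toFun := fun a => a x x, map_zero' := rfl, map_add' := fun _ _ => rfl } : MatAlg V k →+ ℂ) 1
      fun a => by rw [one_mul]; exact CStarMatrix.norm_entry_le_norm (M := a))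
  exact h.comp (continuous_traceSlice k)

theorem factorTrace_mul_comm (k : ℕ) (z w : MinTensor (MatAlg V k) (RedGroupAlg Γ)) :
    factorTrace V Γ k (z * w) = factorTrace V Γ k (w * z) := by
  have hc := continuous_factorTrace (V := V) (Γ := Γ) k
  induction z using MinTensor.induction_on with
  | closed =>
    exact isClosed_eq (hc.comp (continuous_id.mul continuous_const))
      (hc.comp (continuous_const.mul continuous_id))
  | add x y hx hy => rw [add_mul, mul_add, map_add, map_add, hx, hy]
  | tmul a c =>
    induction w using MinTensor.induction_on with
    | closed =>
      exact isClosed_eq (hc.comp (continuous_const.mul continuous_id))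
        (hc.comp (continuous_id.mul continuous_const))
    | add x y hx hy => rw [add_mul, mul_add, map_add, map_add, hx, hy]
    | tmul b d =>
      rw [MinTensor.tmul_mul, MinTensor.tmul_mul, factorTrace_tmul, factorTrace_tmul,
        RedGroupAlg.trace_mul_comm]
      congr 1
      exact Matrix.trace_mul_comm (R := ℂ) a b

/-- Off-diagonal matrix units have trace zero, and diagonal ones carry the label `f(x)⁻¹f(x) = 1`,
of trace one. In particular `ι_k(p_k)` has trace `1` for all `k`, however small its coefficients
are. -/
theorem factorTrace_iotaMap (f : ∀ k, V k → Γ) (k : ℕ) (T : Matrix (V k) (V k) ℂ) :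
    factorTrace V Γ k (iotaMap f k T) = T.trace := by
  classical
  simp only [iotaMap, map_sum, factorTrace_tmul]
  refine Finset.sum_congr rfl fun x _ => ?_
  rw [Finset.sum_eq_single x]
  · rw [inv_mul_cancel, RedGroupAlg.trace_of, if_pos rfl, one_mul]
    exact Matrix.trace_single_eq_same x (T x x)
  · intro y _ hy
    have : ∑ i, (CStarMatrix.ofMatrix (Matrix.single x y (T x y)) : MatAlg V k) i i = 0 :=
      Matrix.trace_single_eq_of_ne x y (T x y) hy.symm
    rw [this, mul_zero]
  · simp

theorem trace_kernelProj {V : ℕ → Type v} [∀ k, Fintype (V k)] (k : ℕ) [Nonempty (V k)] : (kernelProj V k).trace = 1 := by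
  simp [Matrix.trace, kernelProj]

end FactorTrace

/-! ### Components of elements coming from the direct sum. -/

section DirectSum
variable {A : ℕ → Type v} [∀ k, NonUnitalCStarAlgebra (A k)] {C : Type u} [NonUnitalCStarAlgebra C]

/-- The `k`-th component of an element of `(⊕ₖ Aₖ) ⊗ C`. -/
def sumCoordHom (A : ℕ → Type v) [∀ k, NonUnitalCStarAlgebra (A k)] (C : Type u)
    [NonUnitalCStarAlgebra C] (k : ℕ) : MinTensor (SumAlg A) C →⋆ₙₐ[ℂ] MinTensor (A k) C :=
  (MinTensor.map C (coordHom A k)).comp (MinTensor.map C (SumAlg.incl A))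

/-- Clear for elementary tensors, and the families tending to zero form a closed ideal in the
product of the `A k ⊗ C`. -/
theorem tendsto_norm_sumCoordHom (z : MinTensor (SumAlg A) C) :
    Tendsto (fun k => ‖sumCoordHom A C k z‖) atTop (𝓝 0) := by
  -- All components are collected into one homomorphism, so that its continuity makes the condition
  -- on `z` closed.
  let Φ : MinTensor (SumAlg A) C →⋆ₙₐ[ℂ] ProdAlg fun k => MinTensor (A k) C :=
    { toFun := fun z => ⟨fun k => sumCoordHom A C k z, memℓp_infty ⟨‖z‖, by
        rintro _ ⟨k, rfl⟩
        exact NonUnitalStarAlgHom.norm_apply_le (sumCoordHom A C k) z⟩⟩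
      map_smul' := fun _ _ => rfl
      map_zero' := rfl
      map_add' := fun _ _ => rfl
      map_mul' := fun _ _ => rfl
      map_star' := fun _ => rfl }
  change Φ z ∈ sumIdeal _
  induction z using MinTensor.induction_on with
  | closed => exact IsClosed.preimage (continuous_starHom Φ) (isClosed_sumIdeal _)
  | add x y hx hy => rw [map_add]; exact add_mem hx hy
  | tmul a c =>
    have ha : Tendsto (fun k => ‖a.1 k‖ * ‖c‖) atTop (𝓝 0) := by
      have h : Tendsto (fun k => ‖a.1 k‖) atTop (𝓝 0) := a.2
      simpa using h.mul_const ‖c‖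
    exact squeeze_zero (fun _ => norm_nonneg _) (fun k => MinTensor.norm_tmul_le (a.1 k) c) ha

end DirectSum

/-! ### The obstruction and the main theorem. -/

section Conclusion
variable {Γ : Type u} [Group Γ] {V : ℕ → Type v} [∀ k, Fintype (V k)] [∀ k, DecidableEq (V k)]

/-- The class of the projection `q` does not come from the direct sum. -/
theorem map_incl_ne_cls (f : ∀ k, V k → Γ) (hV : ∀ k, Nonempty (V k))
    {q : MinTensor (ProdAlg (MatAlg V)) (RedGroupAlg Γ)} (hq : IsStarProjection q)
    (hc : HasComponents f (kernelProj V) q) (y : K0 (MinTensor (SumAlg (MatAlg V)) (RedGroupAlg Γ))) :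
    K0.map (MinTensor.map (RedGroupAlg Γ) (SumAlg.incl (MatAlg V))) y ≠ K0.cls q hq := by
  intro hy
  -- Any single large `k` suffices: the trace of the `k`-th component of `y` is `0`, while that of
  -- `q` is `1`.
  obtain ⟨k, hk⟩ := (K0.eventually_trace_map_eq_zero (sumCoordHom (MatAlg V) (RedGroupAlg Γ))
    tendsto_norm_sumCoordHom (factorTrace V Γ) factorTrace_mul_comm y).exists
  rw [sumCoordHom, ← K0.map_map, hy, K0.map_cls, K0.trace_cls, hc k, factorTrace_iotaMap,
    trace_kernelProj] at hk
  exact one_ne_zero hk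

theorem exact_incl_mkHom (A : ℕ → Type v) [∀ k, NonUnitalCStarAlgebra (A k)] :
    Function.Exact (SumAlg.incl A) (QuotAlg.mkHom A) := by
  intro x
  have h : QuotAlg.mkHom A x = 0 ↔ x ∈ sumIdeal A :=
    (QuotAlg.mk_eq_mk (y := 0)).trans (by rw [sub_zero])
  rw [h]
  exact ⟨fun hx => ⟨⟨x, hx⟩, rfl⟩, by rintro ⟨y, rfl⟩; exact y.2⟩

end Conclusion

end

theorem mainTheorem1 {Γ : Type u} [Group Γ] (S : Finset Γ)
    (hS : Subgroup.closure (S : Set Γ) = ⊤)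
    {V : ℕ → Type v} [∀ k, Fintype (V k)] [∀ k, DecidableEq (V k)]
    (d : ℕ) (G : ∀ k, SimpleGraph (V k)) [∀ k, DecidableRel (G k).Adj]
    (hG : IsExpanderFamily d G)
    (f : ∀ k, V k → Γ) (hf : IsCoarseEmbeddingFamily (S : Set Γ) G f) :
    ¬ HalfKExact.{u, v} (RedGroupAlg Γ) ∧
    ∃ (Δ q : MinTensor (ProdAlg (MatAlg V)) (RedGroupAlg Γ)) (hq : IsStarProjection q),
      (∀ z, HasComponents f (fun k => (G k).lapMatrix ℂ) z ↔ z = Δ) ∧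
      (∀ z, HasComponents f (kernelProj V) z ↔ z = q) ∧
      IsSelfAdjoint Δ ∧
      (∃ ε : ℝ, 0 < ε ∧ ∀ t ∈ quasispectrum ℝ Δ, t = 0 ∨ ε ≤ t) ∧
      (∃ e : MinTensor (ProdAlg (MatAlg V)) (RedGroupAlg Γ), (∀ z, e * z = z ∧ z * e = z) ∧
        q = e - cfcₙ (fun t : ℝ => if t = 0 then 0 else 1) Δ) ∧
      K0.map (MinTensor.map (RedGroupAlg Γ) (QuotAlg.mkHom (MatAlg V))) (K0.cls q hq) = 0 ∧
      ∀ y, K0.map (MinTensor.map (RedGroupAlg Γ) (SumAlg.incl (MatAlg V))) y ≠ K0.cls q hq := by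
  obtain ⟨ε, hε, h⟩ := hG.gap
  obtain ⟨Δ, hΔ⟩ := exists_hasComponents_lapMatrix f hS hG.regular hf
  obtain ⟨N, hN⟩ := hf.exists_card_fibre_le hG.regular hG.connected
  have hq := hasComponents_kernelProj f h hε hG.connected hΔ
  -- The projection is defined by functional calculus, which gives its existence in the tensor
  -- product; the family `p_k` itself need not have uniformly finite propagation.
  obtain ⟨q, hqe⟩ : ∃ q, q = tensorOne V Γ - cfcₙ (fun t : ℝ => if t = 0 then 0 else 1) Δ := ⟨_, rfl⟩
  rw [← hqe] at hq
  have hproj := HasComponents.isStarProjection f hq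
  have h0 : MinTensor.map (RedGroupAlg Γ) (QuotAlg.mkHom (MatAlg V)) q = 0 :=
    map_mkHom_kernelProj f hN hG.card_tendsto hq
  have h2 : K0.map (MinTensor.map (RedGroupAlg Γ) (QuotAlg.mkHom (MatAlg V))) (K0.cls q hproj) = 0 := by
    have hz : ∀ (z : MinTensor (QuotAlg (MatAlg V)) (RedGroupAlg Γ)) (hz : IsStarProjection z),
        z = 0 → K0.cls z hz = 0 := by
      rintro _ hz rfl
      exact K0.cls_zero hz
    rw [K0.map_cls]
    exact hz _ _ h0
  have h3 := map_incl_ne_cls f (fun k => (hG.connected k).nonempty) hproj hq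
  refine ⟨fun hex => ?_, Δ, q, hproj, HasComponents.eq_iff f hΔ, HasComponents.eq_iff f hq,
    HasComponents.isSelfAdjoint f hΔ,
    ⟨ε, hε, fun t ht => quasispectrum_of_hasComponents_lapMatrix f h hε hΔ ht⟩,
    ⟨tensorOne V Γ, tensorOne_mul, hqe⟩, h2, h3⟩
  -- Only the `K₀` half of half-K-exactness is used, for the extension of the quotient by the direct
  -- sum.
  obtain ⟨y, hy⟩ := ((hex _ _ _ (SumAlg.incl (MatAlg V)) (QuotAlg.mkHom (MatAlg V))
    Subtype.val_injective QuotAlg.mk_surjective (exact_incl_mkHom _)).1 _).1 h2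
  exact h3 y hy
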